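/- Let $K$ be a field of characteristic $\neq 2$, and let $V$ be a finite-dimensional $K$-vector space with a nondegenerate symmetric bilinear form $\langle\cdot,\cdot\rangle$. Assume that $\dim V > 8$ and that the Witt index of $V$ (the largest dimension of a subspace on which the form vanishes identically) has the maximal possible value $p := \lfloor \dim V/2 \rfloor$. For a $K$-vector space $W$ with a symmetric bilinear form and an integer $k \ge 0$, let $$\widehat{Gr}_{\mathrm{iso}}(k,W) := \{\, w_1\wedge\cdots\wedge w_k \;:\; w_1,\dots,w_k\in W,\ \langle w_i,w_j\rangle = 0 \text{ for all } i,j \,\} \subseteq \textstyle\bigwedge^k W$$ denote the isotropic Grassmann cone. For a nonzero isotropic vector $v\in V$ (that is, $v \ne 0$ and $\langle v,v\rangle=0$) put $v^\perp := \{w\in V : \langle v,w\rangle=0\}$ and $V_v := v^\perp/\langle v\rangle$, with the induced form $\langle \bar x,\bar y\rangle := \langle x,y\rangle$ for $x,y\in v^\perp$, and let $$\Phi_v:\ \textstyle\bigwedge^p V \xrightarrow{\ \varphi_v\ } \bigwedge^{p-1} v^\perp \xrightarrow{\ \bigwedge^{p-1}\pi_v\ } \bigwedge^{p-1}V_v ,$$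 where $\pi_v: v^\perp\to V_v$ is the projection and $\varphi_v$ is the contraction map $$\varphi_v(v_1\wedge\cdots\wedge v_p)=\sum_{i=1}^p(-1)^{i-1}\langle v,v_i\rangle\, v_1\wedge\cdots\wedge\widehat{v_i}\wedge\cdots\wedge v_p ,$$ whose values lie in $\bigwedge^{p-1}v^\perp\subseteq\bigwedge^{p-1}V$. Let $\omega\in\bigwedge^p V$. If $\Phi_v(\omega)\in\widehat{Gr}_{\mathrm{iso}}(p-1,V_v)$ for every nonzero isotropic vector $v\in V$, then $\omega\in\widehat{Gr}_{\mathrm{iso}}(p,V)$. -/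

import Mathlib

namespace IsoGrass

noncomputable section

variable {K V : Type*} [Field K] [AddCommGroup V] [Module K V]

/-- A subspace is isotropic if the form vanishes identically on it. -/
def IsIsotropicSubspace (B : LinearMap.BilinForm K V) (L : Submodule K V) : Prop :=
  ∀ x ∈ L, ∀ y ∈ L, B x y = 0

/-- The Witt index: the largest dimension of an isotropic subspace. -/
def wittIndex (B : LinearMap.BilinForm K V) : ℕ :=
  sSup {d : ℕ | ∃ L : Submodule K V, IsIsotropicSubspace B L ∧ Module.finrank K L = d}

/-- The isotropic Grassmann cone: all `w₁ ∧ ⋯ ∧ w_k` with pairwise (and self) orthogonal `w_i`. -/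
def isoGrassmannCone (B : LinearMap.BilinForm K V) (k : ℕ) : Set (⋀[K]^k V) :=
  {ω | ∃ w : Fin k → V, (∀ i j, B (w i) (w j) = 0) ∧ exteriorPower.ιMulti K k w = ω}

/-! ### The contraction `⋀^k V → ⋀^(k-1) (ker β)` -/

/-- Contraction with a linear form `β`, as an endomorphism of the exterior algebra. -/
def contractExt (β : Module.Dual K V) : ExteriorAlgebra K V →ₗ[K] ExteriorAlgebra K V :=
  CliffordAlgebra.contractLeft (Q := (0 : QuadraticForm K V)) β

theorem contractExt_ι_mul (β : Module.Dual K V) (a : V) (x : ExteriorAlgebra K V) :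
    contractExt β (ExteriorAlgebra.ι K a * x)
      = β a • x - ExteriorAlgebra.ι K a * contractExt β x :=
  CliffordAlgebra.contractLeft_ι_mul β a x

theorem contractExt_contractExt (β : Module.Dual K V) (x : ExteriorAlgebra K V) :
    contractExt β (contractExt β x) = 0 :=
  CliffordAlgebra.contractLeft_contractLeft β x

/-- The usual alternating-sum formula for the contraction of `v₀ ∧ ⋯ ∧ v_n`. -/
theorem contractExt_ιMulti (β : Module.Dual K V) (n : ℕ) (v : Fin (n + 1) → V) :
    contractExt β (ExteriorAlgebra.ιMulti K (n + 1) v)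
      = ∑ i : Fin (n + 1), ((-1) ^ (i : ℕ) * β (v i)) •
          ExteriorAlgebra.ιMulti K n (fun j => v (i.succAbove j)) := by
  induction n with
  | zero =>
    rw [ExteriorAlgebra.ιMulti_succ_apply, contractExt_ι_mul]
    simp [contractExt]
  | succ n ih =>
    rw [ExteriorAlgebra.ιMulti_succ_apply, contractExt_ι_mul, ih,
      Fin.sum_univ_succ (n := n + 1), Finset.mul_sum, sub_eq_add_neg, ← Finset.sum_neg_distrib]
    congr 1
    · simp [Matrix.vecTail, Function.comp_def]
    · refine Finset.sum_congr rfl fun i _ => ?_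
      rw [ExteriorAlgebra.ιMulti_succ_apply]
      simp [Matrix.vecTail, Function.comp_def, pow_succ]

theorem contractExt_mem (β : Module.Dual K V) (k : ℕ) (x : ExteriorAlgebra K V)
    (hx : x ∈ ⋀[K]^k V) : contractExt β x ∈ ⋀[K]^(k - 1) V := by
  rw [← ExteriorAlgebra.ιMulti_span_fixedDegree] at hx
  induction hx using Submodule.span_induction with
  | mem x h =>
    obtain ⟨v, rfl⟩ := h
    cases k with
    | zero => simp [contractExt]
    | succ n =>
      rw [contractExt_ιMulti]
      exact Submodule.sum_mem _ fun i _ => Submodule.smul_mem _ _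
        (ExteriorAlgebra.ιMulti_range K n ⟨_, rfl⟩)
  | zero => simp
  | add x y _ _ hx hy => rw [map_add]; exact Submodule.add_mem _ hx hy
  | smul a x _ hx => rw [map_smul]; exact Submodule.smul_mem _ _ hx

/-- Contraction with `β` as a map `⋀^k V → ⋀^(k-1) V` (it is zero for `k = 0`). -/
def contractPower (β : Module.Dual K V) (k : ℕ) : ⋀[K]^k V →ₗ[K] ⋀[K]^(k - 1) V :=
  (contractExt β).restrict (contractExt_mem β k)

theorem coe_map (n : ℕ) {W : Type*} [AddCommGroup W] [Module K W] (f : V →ₗ[K] W)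
    (x : ⋀[K]^n V) :
    (exteriorPower.map n f x : ExteriorAlgebra K W) = ExteriorAlgebra.map f x := by
  have h : (Submodule.subtype _ ∘ₗ exteriorPower.map n f)
      = (ExteriorAlgebra.map f).toLinearMap ∘ₗ (⋀[K]^n V).subtype := by
    apply exteriorPower.linearMap_ext
    ext v
    simp
  exact LinearMap.congr_fun h x

theorem eq_map_add (β : Module.Dual K V) (u : V) (P : V →ₗ[K] V)
    (hP : ∀ m, m = P m + β m • u) (x : ExteriorAlgebra K V) :
    x = ExteriorAlgebra.map P x + ExteriorAlgebra.ι K u * contractExt β x := by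
  induction x using CliffordAlgebra.left_induction with
  | algebraMap r =>
    have : contractExt β (algebraMap K (ExteriorAlgebra K V) r) = 0 :=
      CliffordAlgebra.contractLeft_algebraMap _ _ _
    rw [this, mul_zero, add_zero]
    exact ((ExteriorAlgebra.map P).commutes r).symm
  | add x y hx hy =>
    rw [map_add, map_add, mul_add]
    nth_rewrite 1 [hx, hy]
    abel
  | ι_mul x m hx =>
    change ExteriorAlgebra.ι K m * x = ExteriorAlgebra.map P (ExteriorAlgebra.ι K m * x)
      + ExteriorAlgebra.ι K u * contractExt β (ExteriorAlgebra.ι K m * x)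
    have anti : ExteriorAlgebra.ι K u * ExteriorAlgebra.ι K m
        = - (ExteriorAlgebra.ι K m * ExteriorAlgebra.ι K u) :=
      eq_neg_of_add_eq_zero_left (ExteriorAlgebra.ι_add_mul_swap u m)
    have h1 : ExteriorAlgebra.map P x = x - ExteriorAlgebra.ι K u * contractExt β x :=
      eq_sub_of_add_eq hx.symm
    have h2 : ExteriorAlgebra.ι K (P m)
        = ExteriorAlgebra.ι K m - β m • ExteriorAlgebra.ι K u := by
      rw [← map_smul, ← map_sub]
      exact congrArg _ (eq_sub_of_add_eq (hP m).symm)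
    have sq : ExteriorAlgebra.ι K u * (ExteriorAlgebra.ι K u * contractExt β x) = 0 := by
      rw [← mul_assoc, ExteriorAlgebra.ι_sq_zero, zero_mul]
    rw [map_mul, ExteriorAlgebra.map_apply_ι, contractExt_ι_mul, h1, h2,
      mul_sub (ExteriorAlgebra.ι K u),
      ← mul_assoc (ExteriorAlgebra.ι K u) (ExteriorAlgebra.ι K m), anti]
    simp only [sub_mul, mul_sub, smul_mul_assoc, mul_smul_comm, sq, smul_zero, neg_mul, mul_assoc]
    abel

/-- The contraction with `β` takes values in (the image of) the exterior power of `ker β`. -/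
theorem contractPower_mem (β : Module.Dual K V) (k : ℕ) (x : ⋀[K]^k V) :
    contractPower β k x ∈
      LinearMap.range (exteriorPower.map (k - 1) (LinearMap.ker β).subtype) := by
  by_cases hβ : β = 0
  · subst hβ
    have : contractPower (0 : Module.Dual K V) k x = 0 := by
      ext
      simp [contractPower, contractExt]
    rw [this]
    exact Submodule.zero_mem _
  · obtain ⟨u', hu'⟩ := DFunLike.ne_iff.mp hβ
    have hu' : β u' ≠ 0 := by simpa using hu'
    set u : V := (β u')⁻¹ • u' with hu
    have hβu : β u = 1 := by simp [hu, hu']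
    let P : V →ₗ[K] V := LinearMap.id - β.smulRight u
    have hPk : ∀ m, P m ∈ LinearMap.ker β := fun m => by simp [P, hβu]
    let P' : V →ₗ[K] LinearMap.ker β := P.codRestrict _ hPk
    refine ⟨exteriorPower.map (k - 1) P' (contractPower β k x), ?_⟩
    apply Subtype.ext
    rw [coe_map, coe_map, ← AlgHom.comp_apply, ExteriorAlgebra.map_comp_map]
    have hcomp : (LinearMap.ker β).subtype ∘ₗ P' = P := by
      ext m
      rfl
    rw [hcomp]
    have h := eq_map_add β u P (fun m => by simp [P]) (contractExt β x)
    rw [contractExt_contractExt, mul_zero, add_zero] at h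
    exact h.symm

theorem map_subtype_injective (n : ℕ) (L : Submodule K V) :
    Function.Injective (exteriorPower.map n L.subtype) :=
  exteriorPower.map_injective_field L.injective_subtype

/-- The contraction map `φ_β : ⋀^k V → ⋀^(k-1) (ker β)`: the contraction with `β`, whose values
are viewed in `⋀^(k-1) (ker β)` through the injection `⋀^(k-1) (ker β) → ⋀^(k-1) V`. -/
def contraction (β : Module.Dual K V) (k : ℕ) :
    ⋀[K]^k V →ₗ[K] ⋀[K]^(k - 1) (LinearMap.ker β) :=
  (LinearEquiv.ofInjective _ (map_subtype_injective (k - 1) (LinearMap.ker β))).symm.toLinearMap ∘ₗ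
    (contractPower β k).codRestrict _ (contractPower_mem β k)

/-- The defining property of `contraction`. -/
theorem map_subtype_contraction (β : Module.Dual K V) (k : ℕ) (x : ⋀[K]^k V) :
    exteriorPower.map (k - 1) (LinearMap.ker β).subtype (contraction β k x)
      = contractPower β k x :=
  congrArg Subtype.val ((LinearEquiv.ofInjective _
    (map_subtype_injective (k - 1) (LinearMap.ker β))).apply_symm_apply
      ((contractPower β k).codRestrict _ (contractPower_mem β k) x))

/-! ### The space `V_v = v^⊥ / ⟨v⟩` and the map `Φ_v` -/

/-- The orthogonal complement `v^⊥ = {w | B v w = 0}`. -/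
abbrev perp (B : LinearMap.BilinForm K V) (v : V) : Submodule K V :=
  LinearMap.ker (B v)

/-- The line `⟨v⟩`, as a subspace of `v^⊥` (when `v` is isotropic). -/
abbrev lineIn (B : LinearMap.BilinForm K V) (v : V) : Submodule K (perp B v) :=
  (Submodule.span K {v}).comap (perp B v).subtype

/-- The space `V_v = v^⊥ / ⟨v⟩`. -/
abbrev Red (B : LinearMap.BilinForm K V) (v : V) : Type _ :=
  perp B v ⧸ lineIn B v

/-- The form on `V_v` induced by a symmetric form on `V`:
`⟨[x], [y]⟩ = ⟨x, y⟩` for `x, y ∈ v^⊥`. -/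
def redForm (B : LinearMap.BilinForm K V) (hB : B.IsSymm) (v : V) :
    LinearMap.BilinForm K (Red B v) :=
  LinearMap.liftQ₂ (lineIn B v) (lineIn B v) (B.restrict (perp B v))
    (by
      rintro ⟨x, hx⟩ h
      obtain ⟨c, hc⟩ := Submodule.mem_span_singleton.mp (Submodule.mem_comap.mp h)
      refine LinearMap.mem_ker.mpr (LinearMap.ext fun y => ?_)
      have hc' : c • v = x := hc
      have hy : B v y = 0 := y.2
      simp [← hc', hy])
    (by
      rintro ⟨x, hx⟩ h
      obtain ⟨c, hc⟩ := Submodule.mem_span_singleton.mp (Submodule.mem_comap.mp h)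
      refine LinearMap.mem_ker.mpr (LinearMap.ext fun y => ?_)
      have hc' : c • v = x := hc
      have hy : B y v = 0 := (hB.eq _ _).trans y.2
      simp [← hc', hy])

theorem redForm_mk (B : LinearMap.BilinForm K V) (hB : B.IsSymm) (v : V) (x y : perp B v) :
    redForm B hB v ((lineIn B v).mkQ x) ((lineIn B v).mkQ y) = B x y :=
  rfl

/-- The map `Φ_v : ⋀^k V → ⋀^(k-1) V_v`: contraction with `⟨v, ·⟩`, which takes values in
`⋀^(k-1) v^⊥`, followed by the map induced by the projection `v^⊥ → V_v`. -/
def Phi (B : LinearMap.BilinForm K V) (v : V) (k : ℕ) : ⋀[K]^k V →ₗ[K] ⋀[K]^(k - 1) (Red B v) :=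
  exteriorPower.map (k - 1) (lineIn B v).mkQ ∘ₗ contraction (B v) k

end

end IsoGrass

/-! Through the bilinear form, `ω` becomes an alternating form on `V` (`toForm`). The hypothesis
then says that for every isotropic `v ≠ 0` the form `ω(v, ·)` agrees on `v^⊥` with `w₁ ∧ ⋯ ∧
w_{p-1}`, where the `w i` lie in `v^⊥` and are isotropic and pairwise orthogonal.

Two mechanisms carry the proof. The first is a vanishing criterion
(`VanishesAtIsotropic.vanishesOn`): on a hyperbolic space with at least three pairs, a form of
degree strictly between `0` and the dimension is zero if it vanishes whenever one argument is
isotropic and the others are orthogonal to it. A weak version needs this only when some other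
argument is an `e j`, at the price of checking a few monomials by hand. If all `ω(v, ·)` vanish on
`v^⊥`, the criterion gives `ω = 0`.

Otherwise take an isotropic `a` with `ω(a, ·) = e₁ ∧ ⋯ ∧ e_{p-1} ≠ 0` on `a^⊥`, and complete to a
basis of hyperbolic pairs `(a, b)`, `(e i, f i)` with one anisotropic `z` in odd dimension. The goal
is `ω = b ∧ e₁ ∧ ⋯ ∧ e_{p-1}`. Two changes of basis fixing `a` make `ω(z, f₁, …)` and `ω(a, b,
f_{i₁}, …)` vanish, as they do for this candidate.

The second mechanism is rigidity. For isotropic `v ⟂ a` not orthogonal to all `e i`, the forms `ω(v,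
·)` and `ω(a, ·)` overlap in `ω(a, v, ·)`, which is known. So vectors orthogonal to `v`, `a` and all
`e i` pair with the `w i` proportionally to `a`, and two of them together kill `ω(v, ·)`. With the
criterion, `ω(a, b, ·)` and `ω(z, ·)` vanish on the span of the `e i`, `f i`. For isotropic `v` in
that span, the maximal isotropic space spanned by `v` and the `w i` then contains `b`
(`IsFrame.exists_represents_perp`), so any argument `b` or `e j` orthogonal to `v` kills `ω(v, ·)`
on `v^⊥`. The criterion again removes every component of `ω` except those of the candidate. -/

namespace IsoGrass

variable {K V : Type*} [Field K] [AddCommGroup V] [Module K V]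

/-! ### Elements of exterior powers as alternating forms -/

/-- The alternating form attached to `ω ∈ ⋀^k V` by a bilinear form:
`w₁ ∧ ⋯ ∧ w_k` is sent to `r ↦ det (B (r j) (w i))`. -/
noncomputable def toForm (B : LinearMap.BilinForm K V) (k : ℕ) (ω : ⋀[K]^k V) :
    V [⋀^Fin k]→ₗ[K] K :=
  ((LinearMap.applyₗ ω).compAlternatingMap
    (exteriorPower.alternatingMapToDual K V k)).compLinearMap B

theorem toForm_apply (B : LinearMap.BilinForm K V) (k : ℕ) (ω : ⋀[K]^k V) (r : Fin k → V) :
    toForm B k ω r = exteriorPower.alternatingMapToDual K V k (fun i => B (r i)) ω :=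
  rfl

theorem toForm_ιMulti (B : LinearMap.BilinForm K V) (k : ℕ) (w r : Fin k → V) :
    toForm B k (exteriorPower.ιMulti K k w) r
      = (Matrix.of fun i j => B (r j) (w i)).det := by
  rw [toForm_apply, exteriorPower.alternatingMapToDual_apply_ιMulti]

/-- Two linear functionals on an exterior power agree if they agree on decomposable elements. -/
theorem eq_of_eq_on_ιMulti {k : ℕ} {F G : ⋀[K]^k V →ₗ[K] K}
    (h : ∀ w, F (exteriorPower.ιMulti K k w) = G (exteriorPower.ιMulti K k w))
    (ω : ⋀[K]^k V) : F ω = G ω := by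
  have : F = G := exteriorPower.linearMap_ext (AlternatingMap.ext h)
  rw [this]

/-- On decomposable elements this is the Laplace expansion along the first column. -/
theorem toForm_vecCons (B : LinearMap.BilinForm K V) (k : ℕ) (ω : ⋀[K]^(k + 1) V) (v : V)
    (r : Fin k → V) :
    toForm B (k + 1) ω (Matrix.vecCons v r) = toForm B k (contractPower (B v) (k + 1) ω) r := by
  rw [toForm_apply, toForm_apply]
  refine eq_of_eq_on_ιMulti (F := exteriorPower.alternatingMapToDual K V (k + 1) _)
    (G := exteriorPower.alternatingMapToDual K V k _ ∘ₗ contractPower (B v) (k + 1))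
    (fun w => ?_) ω
  have hc : contractPower (B v) (k + 1) (exteriorPower.ιMulti K (k + 1) w)
      = ∑ i : Fin (k + 1), ((-1) ^ (i : ℕ) * B v (w i)) •
          exteriorPower.ιMulti K k (fun j => w (i.succAbove j)) := by
    apply Subtype.ext
    rw [AddSubmonoidClass.coe_finsetSum]
    exact contractExt_ιMulti (B v) k w
  rw [LinearMap.comp_apply, hc, map_sum, exteriorPower.alternatingMapToDual_apply_ιMulti,
    Matrix.det_succ_column_zero]
  refine Finset.sum_congr rfl fun i _ => ?_
  rw [map_smul, exteriorPower.alternatingMapToDual_apply_ιMulti, smul_eq_mul]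
  rfl

theorem toForm_map {W : Type*} [AddCommGroup W] [Module K W] (B : LinearMap.BilinForm K V)
    (C : LinearMap.BilinForm K W) (g : V →ₗ[K] W) (hg : ∀ x y, C (g x) (g y) = B x y)
    (k : ℕ) (ω : ⋀[K]^k V) (r : Fin k → V) :
    toForm C k (exteriorPower.map k g ω) (fun i => g (r i)) = toForm B k ω r := by
  rw [toForm_apply, toForm_apply]
  refine eq_of_eq_on_ιMulti (F := exteriorPower.alternatingMapToDual K W k _ ∘ₗ
    exteriorPower.map k g) (G := exteriorPower.alternatingMapToDual K V k _) (fun w => ?_) ω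
  rw [LinearMap.comp_apply, exteriorPower.map_apply_ιMulti,
    exteriorPower.alternatingMapToDual_apply_ιMulti,
    exteriorPower.alternatingMapToDual_apply_ιMulti]
  simp [hg]

/-- Nondegeneracy makes `B` surjective onto the dual, so each coordinate of `ω` in a basis of the
exterior power is a value of its form. -/
theorem toForm_injective [FiniteDimensional K V] {B : LinearMap.BilinForm K V}
    (hB : B.Nondegenerate) (k : ℕ) {ω ω' : ⋀[K]^k V} (h : toForm B k ω = toForm B k ω') :
    ω = ω' := by
  let b := Module.finBasis K V
  apply (b.exteriorPower k).repr.injective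
  ext s
  have hsurj : Function.Surjective B := (B.toDual hB).surjective
  rw [exteriorPower.basis_repr_apply, exteriorPower.basis_repr_apply, exteriorPower.ιMultiDual]
  choose g hg using hsurj
  have key : ∀ η : ⋀[K]^k V, exteriorPower.pairingDual K V k
      (exteriorPower.ιMulti_family K k b.coord s) η
      = toForm B k η (fun i => g (b.coord (Set.powersetCard.ofFinEmbEquiv.symm s i))) := by
    intro η
    rw [toForm_apply]
    simp only [hg, exteriorPower.ιMulti_family, exteriorPower.pairingDual,
      exteriorPower.alternatingMapLinearEquiv_apply_ιMulti]
    rfl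
  rw [key, key, h]

/-- If `Φ_v(ω)` lies in the isotropic Grassmann cone then `ω(v, ·)` is a determinant on `v^⊥`,
built from pairwise orthogonal isotropic vectors of `v^⊥`. -/
theorem exists_det_of_Phi_mem {B : LinearMap.BilinForm K V} (hB : B.IsSymm) {k : ℕ}
    {ω : ⋀[K]^(k + 1) V} {v : V}
    (h : Phi B v (k + 1) ω ∈ isoGrassmannCone (redForm B hB v) k) :
    ∃ w : Fin k → V, (∀ i, B v (w i) = 0) ∧ (∀ i j, B (w i) (w j) = 0) ∧
      ∀ r : Fin k → V, (∀ i, B v (r i) = 0) →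
        toForm B (k + 1) ω (Matrix.vecCons v r) = (Matrix.of fun i j => B (r j) (w i)).det := by
  obtain ⟨w, hw, hφ⟩ := h
  -- The lifts are ambiguous only by multiples of `v`, which pair to zero with `v^⊥`.
  choose u hu using fun i => (lineIn B v).mkQ_surjective (w i)
  refine ⟨fun i => u i, fun i => (u i).2, fun i j => ?_, fun r hr => ?_⟩
  · have := hw i j
    rwa [← hu i, ← hu j, redForm_mk] at this
  · let r' : Fin k → perp B v := fun i => ⟨r i, hr i⟩
    have h1 := toForm_map (B.restrict (perp B v)) B (perp B v).subtype (fun _ _ => rfl) k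
      (contraction (B v) (k + 1) ω) r'
    have h2 := toForm_map (B.restrict (perp B v)) (redForm B hB v) (lineIn B v).mkQ
      (fun x y => redForm_mk B hB v x y) k (contraction (B v) (k + 1) ω) r'
    have h3 := map_subtype_contraction (B v) (k + 1) ω
    have h4 : exteriorPower.map k (lineIn B v).mkQ (contraction (B v) (k + 1) ω)
      = exteriorPower.ιMulti K k w := hφ.symm
    rw [toForm_vecCons, ← show exteriorPower.map k (perp B v).subtype
      (contraction (B v) (k + 1) ω) = contractPower (B v) (k + 1) ω from h3]
    refine h1.trans (h2.symm.trans ?_)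
    rw [h4, toForm_ιMulti]
    congr 1
    ext i j
    simp only [Matrix.of_apply]
    rw [← hu i, redForm_mk]

/-! ### Alternating forms vanishing on a subspace -/

/-- The alternating form `η` vanishes on all tuples of vectors of `U`. -/
def VanishesOn {k : ℕ} (η : V [⋀^Fin k]→ₗ[K] K) (U : Submodule K V) : Prop :=
  ∀ t : Fin k → V, (∀ i, t i ∈ U) → η t = 0

theorem vanishesOn_span {k : ℕ} {η : V [⋀^Fin k]→ₗ[K] K} {S : Set V}
    (h : ∀ t : Fin k → V, (∀ i, t i ∈ S) → η t = 0) : VanishesOn η (Submodule.span K S) := by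
  -- `s` is the set of slots whose entries are only known to lie in the span; induction frees one
  -- slot at a time.
  have key : ∀ (s : Finset (Fin k)) (t : Fin k → V), (∀ i, i ∉ s → t i ∈ S) →
      (∀ i, t i ∈ Submodule.span K S) → η t = 0 := by
    intro s
    induction s using Finset.induction_on with
    | empty => exact fun t ht _ => h t fun i => ht i (Finset.notMem_empty i)
    | insert a s _ ih =>
      intro t ht ht'
      have : ∀ x ∈ Submodule.span K S, η (Function.update t a x) = 0 := by
        intro x hx
        induction hx using Submodule.span_induction with
        | mem x hx =>
          refine ih _ (fun i hi => ?_) (fun i => ?_)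
          · rcases eq_or_ne i a with rfl | hia
            · simpa using hx
            · rw [Function.update_of_ne hia]
              exact ht i (by simp [hia, hi])
          · rcases eq_or_ne i a with rfl | hia
            · simpa using Submodule.subset_span hx
            · rw [Function.update_of_ne hia]
              exact ht' i
        | zero => exact η.map_update_zero t a
        | add x y _ _ hx hy => rw [η.map_update_add, hx, hy, add_zero]
        | smul c x _ hx => rw [η.map_update_smul, hx, smul_zero]
      simpa using this (t a) (ht' a)
  exact fun t ht => key Finset.univ t (fun i hi => absurd (Finset.mem_univ i) hi) ht

/-- Moving the entry in position `i` to the front only changes a sign. -/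
theorem map_eq_zero_iff_vecCons {k : ℕ} (η : V [⋀^Fin (k + 1)]→ₗ[K] K) (t : Fin (k + 1) → V)
    (i : Fin (k + 1)) :
    η t = 0 ↔ η (Matrix.vecCons (t i) fun j => t (i.succAbove j)) = 0 := by
  have h := η.map_insertNth i (t i) (fun j => t (i.succAbove j))
  have h' : i.insertNth (t i) (fun j => t (i.succAbove j)) = t :=
    Fin.insertNth_self_removeNth i t
  rw [h'] at h
  rw [h]
  rcases neg_one_pow_eq_or ℤ (i : ℕ) with h | h <;> simp [h]

/-- By alternation `x` can occupy at most one slot, and that slot can be moved to the front. -/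
theorem VanishesOn.sup_span_singleton {k : ℕ} {η : V [⋀^Fin (k + 1)]→ₗ[K] K}
    {U : Submodule K V} {x : V} (h : VanishesOn η U) (hx : VanishesOn (η.curryLeft x) U) :
    VanishesOn η (U ⊔ Submodule.span K {x}) := by
  have hspan : U ⊔ Submodule.span K {x} = Submodule.span K ((U : Set V) ∪ {x}) := by
    rw [Submodule.span_union, Submodule.span_eq]
  rw [hspan]
  refine vanishesOn_span fun t ht => ?_
  by_cases hU : ∀ i, t i ∈ U
  · exact h t hU
  · push Not at hU
    obtain ⟨i, hi⟩ := hU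
    have hxU : ∀ j, t j ∉ U → t j = x := fun j hj => (ht j).resolve_left hj
    by_cases h2 : ∃ j, j ≠ i ∧ t j ∉ U
    · obtain ⟨j, hji, hj⟩ := h2
      exact η.map_eq_zero_of_eq t ((hxU j hj).trans (hxU i hi).symm) hji
    · push Not at h2
      rw [map_eq_zero_iff_vecCons η t i, hxU i hi]
      exact hx _ fun j => h2 _ (Fin.succAbove_ne i j)

/-- The values of an alternating form when the entries in positions `m ≠ m'` vary. -/
noncomputable def slots {k : ℕ} (η : V [⋀^Fin k]→ₗ[K] K) (x : Fin k → V) {m m' : Fin k}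
    (h : m ≠ m') : V →ₗ[K] V →ₗ[K] K :=
  LinearMap.mk₂ K (fun u u' => η (Function.update (Function.update x m u) m' u'))
    (fun u₁ u₂ u' => by
      simp only [Function.update_comm h, η.map_update_add])
    (fun c u u' => by
      simp only [Function.update_comm h, η.map_update_smul])
    (fun u u₁ u₂ => by simp only [η.map_update_add])
    (fun c u u' => by simp only [η.map_update_smul])

theorem slots_apply {k : ℕ} (η : V [⋀^Fin k]→ₗ[K] K) (x : Fin k → V) {m m' : Fin k}
    (h : m ≠ m') (u u' : V) :
    slots η x h u u' = η (Function.update (Function.update x m u) m' u') :=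
  rfl

theorem slots_self {k : ℕ} (η : V [⋀^Fin k]→ₗ[K] K) (x : Fin k → V) {m m' : Fin k}
    (h : m ≠ m') (u : V) : slots η x h u u = 0 :=
  η.map_eq_zero_of_eq _ (by simp [h]) h

theorem slots_swap {k : ℕ} (η : V [⋀^Fin k]→ₗ[K] K) (x : Fin k → V) {m m' : Fin k}
    (h : m ≠ m') (u u' : V) : slots η x h u u' = - slots η x h u' u := by
  have := slots_self η x h (u + u')
  simp only [map_add, LinearMap.add_apply, slots_self] at this
  linear_combination this

theorem slots_eq {k : ℕ} (η : V [⋀^Fin k]→ₗ[K] K) (x : Fin k → V) {m m' : Fin k}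
    (h : m ≠ m') : slots η x h (x m) (x m') = η x := by
  simp [slots_apply]

/-! ### Hyperbolic families -/

/-- The vectors `e i`, `f i` form a family of mutually orthogonal hyperbolic pairs. -/
structure IsHyperbolic {κ : Type*} [DecidableEq κ] (B : LinearMap.BilinForm K V) (e f : κ → V) :
    Prop where
  ee : ∀ i j, B (e i) (e j) = 0
  ff : ∀ i j, B (f i) (f j) = 0
  ef : ∀ i j, B (e i) (f j) = if i = j then 1 else 0
  fe : ∀ i j, B (f i) (e j) = if i = j then 1 else 0

/-- The span of a hyperbolic family. -/
def hypSpan (K : Type*) {V κ : Type*} [Field K] [AddCommGroup V] [Module K V] (e f : κ → V) :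
    Submodule K V :=
  Submodule.span K (Set.range (Sum.elim e f))

theorem left_mem_hypSpan {κ : Type*} (e f : κ → V) (i : κ) : e i ∈ hypSpan K e f :=
  Submodule.subset_span ⟨Sum.inl i, rfl⟩

theorem right_mem_hypSpan {κ : Type*} (e f : κ → V) (i : κ) : f i ∈ hypSpan K e f :=
  Submodule.subset_span ⟨Sum.inr i, rfl⟩

theorem hypSpan_induction {κ : Type*} {e f : κ → V} (g : V →ₗ[K] K) (he : ∀ i, g (e i) = 0)
    (hf : ∀ i, g (f i) = 0) {x : V} (hx : x ∈ hypSpan K e f) : g x = 0 := by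
  have : hypSpan K e f ≤ LinearMap.ker g := by
    refine Submodule.span_le.mpr ?_
    rintro _ ⟨i | i, rfl⟩
    · exact he i
    · exact hf i
  exact this hx

section Hyperbolic

variable {κ : Type*} {B : LinearMap.BilinForm K V} {e f : κ → V}

/-- `η` vanishes on every tuple from the hyperbolic space containing an isotropic vector `v` that
is not orthogonal to all `e i`, and otherwise vectors orthogonal to `v`; unless `c` holds, one of
these other vectors has to be some `e j`. -/
def VanishesAtIsotropic (B : LinearMap.BilinForm K V) (e f : κ → V) (c : Prop) {k : ℕ}
    (η : V [⋀^Fin k]→ₗ[K] K) : Prop :=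
  ∀ s : Fin k → V, (∀ i, s i ∈ hypSpan K e f) → ∀ i₀, B (s i₀) (s i₀) = 0 →
    (∃ i, B (s i₀) (e i) ≠ 0) → (∀ i, i ≠ i₀ → B (s i₀) (s i) = 0) →
    (c ∨ ∃ i, i ≠ i₀ ∧ ∃ j, s i = e j) → η s = 0

variable {c : Prop} {k : ℕ} {η : V [⋀^Fin k]→ₗ[K] K}

theorem VanishesAtIsotropic.slots_eq_zero (H : VanishesAtIsotropic B e f c η)
    {x : Fin k → V} {m m' : Fin k} (h : m ≠ m') {v r : V}
    (hx : ∀ l, l ≠ m → l ≠ m' → x l ∈ hypSpan K e f)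
    (hv : v ∈ hypSpan K e f) (hr : r ∈ hypSpan K e f) (hvv : B v v = 0)
    (hve : ∃ i, B v (e i) ≠ 0) (hvr : B v r = 0) (hvx : ∀ l, l ≠ m → l ≠ m' → B v (x l) = 0)
    (hc : c ∨ ∃ l, l ≠ m ∧ l ≠ m' ∧ ∃ j, x l = e j) : slots η x h v r = 0 := by
  have hm : Function.update (Function.update x m v) m' r m = v := by simp [h]
  have hm' : Function.update (Function.update x m v) m' r m' = r := by simp
  have hl : ∀ l, l ≠ m → l ≠ m' → Function.update (Function.update x m v) m' r l = x l := by
    intro l h1 h2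
    simp [h1, h2]
  rw [slots_apply]
  refine H _ (fun l => ?_) m ?_ ?_ ?_ ?_
  · by_cases h1 : l = m
    · rw [h1, hm]; exact hv
    by_cases h2 : l = m'
    · rw [h2, hm']; exact hr
    rw [hl l h1 h2]; exact hx l h1 h2
  · rwa [hm]
  · rwa [hm]
  · intro l h1
    rw [hm]
    by_cases h2 : l = m'
    · rw [h2, hm']; exact hvr
    rw [hl l h1 h2]; exact hvx l h1 h2
  · refine hc.imp_right ?_
    rintro ⟨l, h1, h2, j, hj⟩
    exact ⟨l, h1, j, by rw [hl l h1 h2, hj]⟩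

variable [DecidableEq κ]

theorem IsHyperbolic.left_eq_zero (hef : IsHyperbolic B e f) {i : κ} {c : κ ⊕ κ}
    (h : c ≠ Sum.inr i) : B (e i) (Sum.elim e f c) = 0 := by
  rcases c with j | j
  · exact hef.ee i j
  · have : i ≠ j := fun hij => h (by rw [hij])
    simp [hef.ef, this]

theorem IsHyperbolic.right_eq_zero (hef : IsHyperbolic B e f) {i : κ} {c : κ ⊕ κ}
    (h : c ≠ Sum.inl i) : B (f i) (Sum.elim e f c) = 0 := by
  rcases c with j | j
  · have : i ≠ j := fun hij => h (by rw [hij])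
    simp [hef.fe, this]
  · exact hef.ff i j

/-- The relations coming from the isotropic vectors `f i ± e j` and their orthogonal vectors
`e i ∓ f j`. -/
theorem VanishesAtIsotropic.exchange (hK : (2 : K) ≠ 0) (hef : IsHyperbolic B e f)
    (H : VanishesAtIsotropic B e f c η) {x : Fin k → V} {m m' : Fin k} (h : m ≠ m') {i j : κ}
    (hij : i ≠ j) (hx : ∀ l, l ≠ m → l ≠ m' → x l ∈ hypSpan K e f)
    (hfx : ∀ l, l ≠ m → l ≠ m' → B (f i) (x l) = 0)
    (hex : ∀ l, l ≠ m → l ≠ m' → B (e j) (x l) = 0)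
    (hc : c ∨ ∃ l, l ≠ m ∧ l ≠ m' ∧ ∃ j, x l = e j) :
    slots η x h (e j) (e i) = slots η x h (f i) (f j) ∧
      slots η x h (f i) (e i) = slots η x h (e j) (f j) := by
  have key : ∀ t : K, t ^ 2 = 1 → slots η x h (f i + t • e j) (e i - t • f j) = 0 := by
    intro t ht
    have e1 := left_mem_hypSpan (K := K) e f
    have f1 := right_mem_hypSpan (K := K) e f
    refine H.slots_eq_zero h hx (add_mem (f1 i) (Submodule.smul_mem _ _ (e1 j)))
      (sub_mem (e1 i) (Submodule.smul_mem _ _ (f1 j))) ?_ ⟨i, ?_⟩ ?_ ?_ hc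
    · simp [hef.ff, hef.ee, hef.ef, hef.fe, hij, hij.symm]
    · simp [hef.ee, hef.fe]
    · simp [hef.ff, hef.ee, hef.ef, hef.fe]
      linear_combination -ht
    · intro l h1 h2
      simp [hfx l h1 h2, hex l h1 h2]
  -- With `S` the `slots` form and `t² = 1`, `key t` reads `S(f i, e i) - S(e j, f j) + t (S(e j, e
  -- i) - S(f i, f j)) = 0`; the two signs of `t` separate the parts.
  have k1 := key 1 (by norm_num)
  have k2 := key (-1) (by norm_num)
  simp only [map_add, map_sub, map_smul, LinearMap.add_apply, LinearMap.smul_apply,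
    smul_eq_mul] at k1 k2
  constructor
  · apply mul_left_cancel₀ hK
    linear_combination k1 - k2
  · apply mul_left_cancel₀ hK
    linear_combination k1 + k2

/-- The relation coming from the isotropic vector `f i + f j`. -/
theorem VanishesAtIsotropic.exchange_right (hef : IsHyperbolic B e f)
    (H : VanishesAtIsotropic B e f c η) {x : Fin k → V} {m m' : Fin k} (h : m ≠ m') {i j : κ}
    (hij : i ≠ j) (hx : ∀ l, l ≠ m → l ≠ m' → x l ∈ hypSpan K e f)
    (hfi : ∀ l, l ≠ m → l ≠ m' → B (f i) (x l) = 0)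
    (hfj : ∀ l, l ≠ m → l ≠ m' → B (f j) (x l) = 0)
    (hc : c ∨ ∃ l, l ≠ m ∧ l ≠ m' ∧ ∃ j, x l = e j) :
    slots η x h (f i) (e i) = slots η x h (f j) (e j) := by
  have e1 := left_mem_hypSpan (K := K) e f
  have f1 := right_mem_hypSpan (K := K) e f
  have k0 : slots η x h (f i + f j) (e i - e j) = 0 := by
    refine H.slots_eq_zero h hx (add_mem (f1 i) (f1 j)) (sub_mem (e1 i) (e1 j)) ?_ ⟨i, ?_⟩ ?_ ?_ hc
    · simp [hef.ff]
    · simp [hef.fe, hij.symm]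
    · simp [hef.fe, hij, hij.symm]
    · intro l h1 h2
      simp [hfi l h1 h2, hfj l h1 h2]
  have k1 : slots η x h (f i) (e j) = 0 :=
    H.slots_eq_zero h hx (f1 i) (e1 j) (hef.ff i i) ⟨i, by simp [hef.fe]⟩
      (by simp [hef.fe, hij]) hfi hc
  have k2 : slots η x h (f j) (e i) = 0 :=
    H.slots_eq_zero h hx (f1 j) (e1 i) (hef.ff j j) ⟨j, by simp [hef.fe]⟩
      (by simp [hef.fe, hij.symm]) hfj hc
  simp only [map_add, map_sub, LinearMap.add_apply] at k0
  linear_combination k0 + k1 - k2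

end Hyperbolic

/-! ### The vanishing criterion on a hyperbolic space, monomial by monomial -/

section Vanishing

variable {κ : Type*} [DecidableEq κ] {B : LinearMap.BilinForm K V} {e f : κ → V}
variable {c : Prop} {k : ℕ} {η : V [⋀^Fin k]→ₗ[K] K}

/-- Since `e i` does not occur, the isotropic vector `f i` is orthogonal to every entry. -/
theorem VanishesAtIsotropic.eq_zero_of_right (hef : IsHyperbolic B e f)
    (H : VanishesAtIsotropic B e f c η) {t : Fin k → κ ⊕ κ} {m : Fin k} {i : κ}
    (hm : t m = Sum.inr i) (hi : ∀ l, t l ≠ Sum.inl i) (hc : c ∨ ∃ l j, t l = Sum.inl j) :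
    η (fun l => Sum.elim e f (t l)) = 0 := by
  refine H _ (fun l => Submodule.subset_span ⟨t l, rfl⟩) m ?_ ⟨i, ?_⟩ ?_ ?_
  · simp [hm, hef.ff]
  · simp [hm, hef.fe]
  · intro l _
    simp only [hm, Sum.elim_inr]
    exact hef.right_eq_zero (hi l)
  · refine hc.imp_right ?_
    rintro ⟨l, j, hl⟩
    refine ⟨l, ?_, j, by simp [hl]⟩
    rintro rfl
    simp [hm] at hl

/-- Both `f i` and `f i + e j` are isotropic and orthogonal to all entries, so putting either into
slot `m` gives zero; subtract. -/
theorem VanishesAtIsotropic.eq_zero_of_left_of_missing (hef : IsHyperbolic B e f)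
    (H : VanishesAtIsotropic B e f c η) {t : Fin k → κ ⊕ κ} {m : Fin k} {i j : κ}
    (hm : t m = Sum.inl j) (hj : ∀ l, t l ≠ Sum.inr j) (hi : ∀ l, t l ≠ Sum.inl i)
    (hc : c ∨ ∃ l, l ≠ m ∧ ∃ j, t l = Sum.inl j) :
    η (fun l => Sum.elim e f (t l)) = 0 := by
  have hij : i ≠ j := fun h => hi m (h ▸ hm)
  have hu : ∀ (u : V) (l : Fin k), l ≠ m →
      Function.update (fun l => Sum.elim e f (t l)) m u l = Sum.elim e f (t l) :=
    fun u l hl => by simp [hl]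
  have key : ∀ u ∈ hypSpan K e f, B u u = 0 → B u (e i) ≠ 0 →
      (∀ l, B u (Sum.elim e f (t l)) = 0) →
      η (Function.update (fun l => Sum.elim e f (t l)) m u) = 0 := by
    intro u hu1 huu hue hut
    refine H _ (fun l => ?_) m ?_ ⟨i, ?_⟩ ?_ ?_
    · by_cases hl : l = m
      · simpa [hl] using hu1
      · rw [hu u l hl]
        exact Submodule.subset_span ⟨t l, rfl⟩
    · simpa using huu
    · simpa using hue
    · intro l hl
      rw [hu u l hl]
      simpa using hut l
    · refine hc.imp_right ?_
      rintro ⟨l, hl, j, hj⟩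
      exact ⟨l, hl, j, by rw [hu u l hl, hj, Sum.elim_inl]⟩
  have e1 := left_mem_hypSpan (K := K) e f
  have f1 := right_mem_hypSpan (K := K) e f
  have h1 := key (f i) (f1 i) (hef.ff i i) (by simp [hef.fe]) fun l => hef.right_eq_zero (hi l)
  have h2 := key (f i + e j) (add_mem (f1 i) (e1 j))
    (by simp [hef.ff, hef.ee, hef.fe, hef.ef, hij, hij.symm]) (by simp [hef.fe, hef.ee])
    fun l => by simp [hef.right_eq_zero (hi l), hef.left_eq_zero (hj l)]
  rw [η.map_update_add, h1, zero_add] at h2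
  have h3 : Function.update (fun l => Sum.elim e f (t l)) m (e j)
      = fun l => Sum.elim e f (t l) := by
    have : e j = (fun l => Sum.elim e f (t l)) m := by simp [hm]
    rw [this, Function.update_eq_self]
  rwa [h3] at h2

/-- The exchange relation trades `e j, e i` for `f i, f j`. After that `e i` is gone, so `f i` is
orthogonal to every entry. -/
theorem VanishesAtIsotropic.eq_zero_of_left_left (hK : (2 : K) ≠ 0) (hef : IsHyperbolic B e f)
    (H : VanishesAtIsotropic B e f c η) {t : Fin k → κ ⊕ κ} (ht : Function.Injective t)
    {m m' : Fin k} {i j : κ} (hm : t m = Sum.inl j) (hm' : t m' = Sum.inl i) (hij : i ≠ j)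
    (hj : ∀ l, t l ≠ Sum.inr j) (hc : c ∨ ∃ l, l ≠ m ∧ l ≠ m' ∧ ∃ j, t l = Sum.inl j) :
    η (fun l => Sum.elim e f (t l)) = 0 := by
  have hmm : m ≠ m' := by
    rintro rfl
    rw [hm] at hm'
    exact hij (Sum.inl_injective hm').symm
  have hi : ∀ l, l ≠ m → l ≠ m' → t l ≠ Sum.inl i := fun l _ h2 h =>
    h2 (ht (h.trans hm'.symm))
  have hmem : ∀ l, l ≠ m → l ≠ m' → Sum.elim e f (t l) ∈ hypSpan K e f :=
    fun l _ _ => Submodule.subset_span ⟨t l, rfl⟩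
  have hc' : c ∨ ∃ l, l ≠ m ∧ l ≠ m' ∧ ∃ j, Sum.elim e f (t l) = e j := by
    refine hc.imp_right ?_
    rintro ⟨l, h1, h2, j, h3⟩
    exact ⟨l, h1, h2, j, by rw [h3, Sum.elim_inl]⟩
  have h1 := (H.exchange hK hef (x := fun l => Sum.elim e f (t l)) hmm hij hmem
    (fun l h1 h2 => hef.right_eq_zero (hi l h1 h2)) (fun l _ _ => hef.left_eq_zero (hj l)) hc').1
  have h2 := H.slots_eq_zero (x := fun l => Sum.elim e f (t l)) hmm hmem
    (right_mem_hypSpan e f i) (right_mem_hypSpan e f j) (hef.ff i i) ⟨i, by simp [hef.fe]⟩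
    (hef.ff i j) (fun l h1 h2 => hef.right_eq_zero (hi l h1 h2)) hc'
  have h3 := slots_eq η (fun l => Sum.elim e f (t l)) hmm
  simp only [hm, hm', Sum.elim_inl] at h3
  rw [← h3, h1, h2]

/-- Passing through the unused index `i`, the exchange relations give `S(e j, f j) = S(f i, e i) =
S(f j, e j)` for the `slots` form `S`, which is alternating; hence `2 S(e j, f j) = 0`. -/
theorem VanishesAtIsotropic.eq_zero_of_pair (hK : (2 : K) ≠ 0) (hef : IsHyperbolic B e f)
    (H : VanishesAtIsotropic B e f c η) {t : Fin k → κ ⊕ κ} (ht : Function.Injective t)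
    {m m' : Fin k} {i j : κ} (hm : t m = Sum.inl j) (hm' : t m' = Sum.inr j)
    (hi : ∀ l, t l ≠ Sum.inl i) (hc : c ∨ ∃ l, l ≠ m ∧ l ≠ m' ∧ ∃ j, t l = Sum.inl j) :
    η (fun l => Sum.elim e f (t l)) = 0 := by
  have hij : i ≠ j := fun h => hi m (h ▸ hm)
  have hmm : m ≠ m' := by
    rintro rfl
    simp [hm] at hm'
  have hj : ∀ l, l ≠ m → l ≠ m' → t l ≠ Sum.inl j := fun l h1 _ h =>
    h1 (ht (h.trans hm.symm))
  have hj' : ∀ l, l ≠ m → l ≠ m' → t l ≠ Sum.inr j := fun l _ h2 h =>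
    h2 (ht (h.trans hm'.symm))
  have hmem : ∀ l, l ≠ m → l ≠ m' → Sum.elim e f (t l) ∈ hypSpan K e f :=
    fun l _ _ => Submodule.subset_span ⟨t l, rfl⟩
  have hc' : c ∨ ∃ l, l ≠ m ∧ l ≠ m' ∧ ∃ j, Sum.elim e f (t l) = e j := by
    refine hc.imp_right ?_
    rintro ⟨l, h1, h2, j, h3⟩
    exact ⟨l, h1, h2, j, by rw [h3, Sum.elim_inl]⟩
  have h1 := (H.exchange hK hef (x := fun l => Sum.elim e f (t l)) hmm hij hmem
    (fun l _ _ => hef.right_eq_zero (hi l)) (fun l h1 h2 => hef.left_eq_zero (hj' l h1 h2)) hc').2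
  have h2 := H.exchange_right hef (x := fun l => Sum.elim e f (t l)) hmm hij hmem
    (fun l _ _ => hef.right_eq_zero (hi l)) (fun l h1 h2 => hef.right_eq_zero (hj l h1 h2)) hc'
  have h3 := slots_eq η (fun l => Sum.elim e f (t l)) hmm
  simp only [hm, hm', Sum.elim_inl, Sum.elim_inr] at h3
  have h4 := slots_swap η (fun l => Sum.elim e f (t l)) hmm (e j) (f j)
  rw [← h3]
  apply mul_left_cancel₀ hK
  linear_combination h4 + h2 - h1

/-- A form of degree strictly between `0` and the dimension of a hyperbolic space vanishes on that
space as soon as it vanishes at isotropic vectors; in the weak version, where `c` does not hold,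
it also has to vanish on the `f i`, and on the planes spanned by `e j` and `f j`. -/
theorem VanishesAtIsotropic.vanishesOn [Fintype κ] (hK : (2 : K) ≠ 0) (hef : IsHyperbolic B e f)
    (H : VanishesAtIsotropic B e f c η) (hκ : 3 ≤ Fintype.card κ) (hk₀ : 0 < k)
    (hk : k < 2 * Fintype.card κ)
    (hf : c ∨ ∀ t : Fin k → κ, Function.Injective t → η (fun l => f (t l)) = 0)
    (hpair : c ∨ ∀ t : Fin k → κ ⊕ κ, Function.Injective t →
      ∀ j, (∀ l, t l = Sum.inl j ∨ t l = Sum.inr j) → η (fun l => Sum.elim e f (t l)) = 0) :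
    VanishesOn η (hypSpan K e f) := by
  refine vanishesOn_span fun x hx => ?_
  choose t hxt using hx
  obtain rfl : (fun l => Sum.elim e f (t l)) = x := funext hxt
  clear hxt
  by_cases ht : Function.Injective t
  swap
  · refine η.map_eq_zero_of_not_injective _ fun h => ht fun l l' hll => h ?_
    simp only [hll]
  by_contra hne
  by_cases hI : ∃ l j, t l = Sum.inl j
  swap
  · have hr : ∀ l, ∃ j, t l = Sum.inr j := by
      intro l
      rcases h : t l with j | j
      · exact absurd ⟨l, j, h⟩ hI
      · exact ⟨j, rfl⟩
    rcases hf with hc | hf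
    · obtain ⟨j, hj⟩ := hr ⟨0, hk₀⟩
      exact hne (H.eq_zero_of_right hef hj (fun l hl => hI ⟨l, j, hl⟩) (Or.inl hc))
    · choose τ hτ using hr
      refine hne ?_
      have := hf τ (fun l l' h => ht (by rw [hτ, hτ, h]))
      simpa [hτ] using this
  -- In a nonvanishing monomial every `f i` is accompanied by `e i`.
  have hJI : ∀ m i, t m = Sum.inr i → ∃ l, t l = Sum.inl i := by
    intro m i hm
    by_contra h
    exact hne (H.eq_zero_of_right hef hm (fun l hl => h ⟨l, hl⟩) (Or.inr hI))
  -- The weak version needs an `e i` besides the ones being manipulated; by `hJI`, its absence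
  -- confines the monomial to `{e j, f j}`, which `hpair` handles.
  have more : ∀ j, c ∨ ∃ l i, i ≠ j ∧ t l = Sum.inl i := by
    intro j
    refine hpair.imp_right fun hpair => ?_
    by_contra h
    refine hne (hpair t ht j fun l => ?_)
    have hall : ∀ l i, t l = Sum.inl i → i = j := fun l i hl => by
      by_contra hi
      exact h ⟨l, i, hi, hl⟩
    rcases hl : t l with i | i
    · exact Or.inl (by rw [hall l i hl])
    · obtain ⟨l', hl'⟩ := hJI l i hl
      exact Or.inr (by rw [hall l' i hl'])
  by_cases hmis : ∃ i, ∀ l, t l ≠ Sum.inl i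
  · obtain ⟨i, hi⟩ := hmis
    by_cases hd : ∃ m j, t m = Sum.inl j ∧ ∀ l, t l ≠ Sum.inr j
    · obtain ⟨m, j, hm, hj⟩ := hd
      refine hne (H.eq_zero_of_left_of_missing hef hm hj hi ((more j).imp_right ?_))
      rintro ⟨l, i', hi', hl⟩
      refine ⟨l, ?_, i', hl⟩
      rintro rfl
      rw [hm] at hl
      exact hi' (Sum.inl_injective hl).symm
    · push Not at hd
      obtain ⟨m, j, hm⟩ := hI
      obtain ⟨m', hm'⟩ := hd m j hm
      refine hne (H.eq_zero_of_pair hK hef ht hm hm' hi ((more j).imp_right ?_))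
      rintro ⟨l, i', hi', hl⟩
      refine ⟨l, ?_, ?_, i', hl⟩
      · rintro rfl
        rw [hm] at hl
        exact hi' (Sum.inl_injective hl).symm
      · rintro rfl
        simp [hm'] at hl
  · push Not at hmis
    -- All `e i` occur; the degree is below the number of basis vectors, so some `f j` is missing.
    obtain ⟨j, hj⟩ : ∃ j, ∀ l, t l ≠ Sum.inr j := by
      by_contra h
      push Not at h
      have hsurj : Function.Surjective t := by
        rintro (i | i)
        · exact hmis i
        · exact h i
      have := Fintype.card_le_of_surjective t hsurj
      simp only [Fintype.card_sum, Fintype.card_fin] at this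
      omega
    obtain ⟨i, hi⟩ : ∃ i, i ∉ ({j} : Finset κ) := by
      by_contra h
      push Not at h
      have := Finset.card_le_card (fun i _ => h i : Finset.univ ⊆ ({j} : Finset κ))
      simp only [Finset.card_univ, Finset.card_singleton] at this
      omega
    -- A third index, supplying the extra `e` entry demanded by the weak version.
    obtain ⟨i', hi'⟩ : ∃ i', i' ∉ ({i, j} : Finset κ) := by
      by_contra h
      push Not at h
      have := Finset.card_le_card (fun i' _ => h i' : Finset.univ ⊆ ({i, j} : Finset κ))
      have h2 := Finset.card_le_two (a := i) (b := j)
      simp only [Finset.card_univ] at this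
      omega
    simp only [Finset.mem_singleton] at hi
    simp only [Finset.mem_insert, Finset.mem_singleton, not_or] at hi'
    obtain ⟨m, hm⟩ := hmis j
    obtain ⟨m', hm'⟩ := hmis i
    obtain ⟨l, hl⟩ := hmis i'
    refine hne (H.eq_zero_of_left_left hK hef ht hm hm' hi hj (Or.inr ⟨l, ?_, ?_, i', hl⟩))
    · rintro rfl
      rw [hm] at hl
      exact hi'.2 (Sum.inl_injective hl).symm
    · rintro rfl
      rw [hm'] at hl
      exact hi'.1 (Sum.inl_injective hl).symm

end Vanishing

/-! ### Hyperbolic bases -/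

/-- Linearly independent, pairwise orthogonal isotropic vectors extend to a hyperbolic family. -/
theorem exists_isHyperbolic [FiniteDimensional K V] (hK : (2 : K) ≠ 0)
    {B : LinearMap.BilinForm K V} (hsymm : B.IsSymm) (hnd : B.Nondegenerate) {n : ℕ}
    {e : Fin n → V} (he : LinearIndependent K e) (hee : ∀ i j, B (e i) (e j) = 0) :
    ∃ f : Fin n → V, IsHyperbolic B e f := by
  obtain ⟨g, hg⟩ := LinearMap.exists_leftInverse_of_injective
    (Finsupp.linearCombination K e) (LinearMap.ker_eq_bot.mpr he)
  have hge : ∀ i j, g (e i) j = if i = j then 1 else 0 := by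
    intro i j
    have := LinearMap.congr_fun hg (Finsupp.single i 1)
    simp only [LinearMap.comp_apply, Finsupp.linearCombination_single, one_smul,
      LinearMap.id_apply] at this
    rw [this, Finsupp.single_apply]
  let d : Fin n → V := fun j => (B.toDual hnd).symm (Finsupp.lapply j ∘ₗ g)
  have hd : ∀ j x, B (d j) x = g x j := fun j x =>
    LinearMap.BilinForm.apply_toDual_symm_apply (hB := hnd) (Finsupp.lapply j ∘ₗ g) x
  have hde : ∀ i j, B (d i) (e j) = if i = j then 1 else 0 := fun i j => by
    rw [hd, hge]
    simp only [eq_comm]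
  have hed : ∀ i j, B (e i) (d j) = if i = j then 1 else 0 := fun i j => by
    rw [hsymm.eq, hd, hge]
  -- The `d j` are dual to the `e i` but not isotropic; adding half of their Gram matrix along the
  -- `e i` cancels all products and keeps the duality.
  let f : Fin n → V := fun j => d j - ∑ i, (2⁻¹ * B (d j) (d i)) • e i
  have hef : ∀ i j, B (e i) (f j) = if i = j then 1 else 0 := by
    intro i j
    simp [f, hed, hee]
  refine ⟨f, hee, fun i j => ?_, hef, fun i j => ?_⟩
  · have h1 : B (f i) (f j) = B (d i) (f j) - ∑ l, (2⁻¹ * B (d i) (d l)) * B (e l) (f j) := by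
      simp [f]
    have h2 : B (d i) (f j) = B (d i) (d j) - 2⁻¹ * B (d j) (d i) := by
      simp [f, hde]
    have h3 : B (d j) (d i) = B (d i) (d j) := hsymm.eq _ _
    rw [h1, h2, h3]
    simp only [hef, mul_ite, mul_one, mul_zero, Finset.sum_ite_eq', Finset.mem_univ, if_true]
    field_simp
    ring
  · rw [hsymm.eq, hef]
    simp only [eq_comm]

section

variable {κ : Type*} [Fintype κ] [DecidableEq κ] {B : LinearMap.BilinForm K V} {e f : κ → V}

theorem IsHyperbolic.coeff_eq_zero (hef : IsHyperbolic B e f) {g : κ ⊕ κ → K} {z : V}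
    (hg : ∑ l, g l • Sum.elim e f l = z) (hze : ∀ i, B (e i) z = 0) (hzf : ∀ i, B (f i) z = 0)
    (l : κ ⊕ κ) : g l = 0 := by
  subst hg
  rcases l with i | i
  · simpa [hef.fe, hef.ff] using hzf i
  · simpa [hef.ef, hef.ee] using hze i

theorem IsHyperbolic.finrank_hypSpan (hef : IsHyperbolic B e f) :
    Module.finrank K (hypSpan K e f) = 2 * Fintype.card κ := by
  have : LinearIndependent K (Sum.elim e f) :=
    Fintype.linearIndependent_iff.mpr fun g hg l => hef.coeff_eq_zero hg (by simp) (by simp) l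
  rw [hypSpan, finrank_span_eq_card this, Fintype.card_sum, two_mul]

/-- A hyperbolic family of maximal size spans everything up to at most one vector. -/
theorem IsHyperbolic.exists_complement [FiniteDimensional K V] (hsymm : B.IsSymm)
    (hnd : B.Nondegenerate) (hef : IsHyperbolic B e f)
    (hdim : Module.finrank K V / 2 = Fintype.card κ) :
    ∃ z : V, (∀ i, B z (e i) = 0) ∧ (∀ i, B z (f i) = 0) ∧
      hypSpan K e f ⊔ Submodule.span K {z} = ⊤ ∧
      ((z = 0 ∧ Module.finrank K V = 2 * Fintype.card κ) ∨
        (B z z ≠ 0 ∧ Module.finrank K V = 2 * Fintype.card κ + 1)) := by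
  have hfr := hef.finrank_hypSpan
  rcases (by omega : Module.finrank K V = 2 * Fintype.card κ ∨
    Module.finrank K V = 2 * Fintype.card κ + 1) with h | h
  · refine ⟨0, by simp, by simp, ?_, Or.inl ⟨rfl, h⟩⟩
    rw [Submodule.span_zero_singleton, sup_bot_eq]
    exact Submodule.eq_top_of_finrank_eq (hfr.trans h.symm)
  · have ho := LinearMap.BilinForm.finrank_orthogonal hnd (hypSpan K e f)
    have hpos : 0 < Module.finrank K (B.orthogonal (hypSpan K e f)) := by omega
    have : Nontrivial (B.orthogonal (hypSpan K e f)) := Module.finrank_pos_iff.mp hpos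
    obtain ⟨⟨z, hz⟩, hz0⟩ := exists_ne (0 : B.orthogonal (hypSpan K e f))
    replace hz0 : z ≠ 0 := fun h0 => hz0 (Subtype.ext h0)
    rw [LinearMap.BilinForm.mem_orthogonal_iff] at hz
    have hez : ∀ i, B (e i) z = 0 := fun i => hz _ (left_mem_hypSpan e f i)
    have hfz : ∀ i, B (f i) z = 0 := fun i => hz _ (right_mem_hypSpan e f i)
    have hze : ∀ i, B z (e i) = 0 := fun i => (hsymm.eq _ _).trans (hez i)
    have hzf : ∀ i, B z (f i) = 0 := fun i => (hsymm.eq _ _).trans (hfz i)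
    have hnot : z ∉ hypSpan K e f := by
      intro hzm
      obtain ⟨g, hg⟩ := (Submodule.mem_span_range_iff_exists_fun K).mp hzm
      apply hz0
      rw [← hg]
      exact Finset.sum_eq_zero fun l _ => by rw [hef.coeff_eq_zero hg hez hfz l, zero_smul]
    have htop : hypSpan K e f ⊔ Submodule.span K {z} = ⊤ := by
      have hlt : hypSpan K e f < hypSpan K e f ⊔ Submodule.span K {z} := by
        refine lt_of_le_of_ne le_sup_left fun heq => hnot ?_
        rw [heq]
        exact Submodule.mem_sup_right (Submodule.mem_span_singleton_self z)
      have h1 := Submodule.finrank_lt_finrank_of_lt hlt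
      have h2 := Submodule.finrank_le (hypSpan K e f ⊔ Submodule.span K {z})
      exact Submodule.eq_top_of_finrank_eq (by omega)
    -- If `z` were isotropic it would be orthogonal to all of `V`.
    refine ⟨z, hze, hzf, htop, Or.inr ⟨fun hzz => hz0 ?_, h⟩⟩
    have hall : ∀ x, B z x = 0 := by
      intro x
      have hx : x ∈ hypSpan K e f ⊔ Submodule.span K {z} := htop ▸ Submodule.mem_top
      obtain ⟨y, hy, y', hy', rfl⟩ := Submodule.mem_sup.mp hx
      obtain ⟨c, rfl⟩ := Submodule.mem_span_singleton.mp hy'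
      rw [map_add, map_smul, hzz, smul_zero, add_zero]
      exact hypSpan_induction (B z) hze hzf hy
    exact hnd.1 z hall

end

/-! ### Determinants -/

/-- A combination of the `w i` orthogonal to all `r j` is trivial because the matrix is invertible.
Since `v` is orthogonal to all `r j`, it cannot be such a combination. -/
theorem linearIndependent_vecCons_of_det_ne_zero {B : LinearMap.BilinForm K V}
    (hsymm : B.IsSymm) {n : ℕ} {v : V} {w r : Fin n → V} (hv : v ≠ 0)
    (hr : ∀ j, B v (r j) = 0) (hdet : (Matrix.of fun i j => B (r j) (w i)).det ≠ 0) :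
    LinearIndependent K (Matrix.vecCons v w) := by
  have key : ∀ g : Fin n → K, (∀ j, B (r j) (∑ i, g i • w i) = 0) → g = 0 := by
    intro g hg
    refine Matrix.eq_zero_of_vecMul_eq_zero hdet (funext fun j => ?_)
    simpa [Matrix.vecMul, dotProduct] using hg j
  refine linearIndependent_finCons.mpr ⟨Fintype.linearIndependent_iff.mpr fun g hg i => ?_, ?_⟩
  · exact congrFun (key g fun j => by rw [hg, map_zero]) i
  · intro hmem
    obtain ⟨g, hg⟩ := (Submodule.mem_span_range_iff_exists_fun K).mp hmem
    have h0 := key g fun j => by rw [hg, hsymm.eq, hr]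
    apply hv
    rw [← hg, h0]
    simp

/-- By Cramer's rule, these determinants are, up to `det A`, the coefficients of `y` along all
columns but the first. -/
theorem eq_smul_col_zero_of_det_updateCol {n : ℕ}
    {A : Matrix (Fin (n + 1)) (Fin (n + 1)) K} (hA : A.det ≠ 0) {y : Fin (n + 1) → K}
    (hy : ∀ l : Fin n, (A.updateCol l.succ y).det = 0) : ∃ μ : K, ∀ i, y i = μ * A i 0 := by
  refine ⟨A.det⁻¹ * A.cramer y 0, fun i => ?_⟩
  have h := congrFun (Matrix.mulVec_cramer A y) i
  have h0 : ∀ l : Fin n, A.cramer y l.succ = 0 := fun l => by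
    rw [Matrix.cramer_apply, hy]
  simp only [Matrix.mulVec, dotProduct, Fin.sum_univ_succ, h0, mul_zero, Finset.sum_const_zero,
    add_zero, Pi.smul_apply, smul_eq_mul] at h
  field_simp
  linear_combination -h

theorem det_eq_zero_of_col_proportional {n : Type*} [Fintype n] [DecidableEq n]
    {A : Matrix n n K} {j₁ j₂ : n} (hj : j₁ ≠ j₂) {x : n → K} {μ₁ μ₂ : K}
    (h₁ : ∀ i, A i j₁ = μ₁ * x i) (h₂ : ∀ i, A i j₂ = μ₂ * x i) : A.det = 0 := by
  by_cases hμ : μ₁ = 0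
  · exact Matrix.det_eq_zero_of_column_eq_zero j₁ fun i => by rw [h₁, hμ, zero_mul]
  · refine Matrix.exists_mulVec_eq_zero_iff.mp
      ⟨Pi.single j₁ μ₂ - Pi.single j₂ μ₁, fun h => hμ ?_, ?_⟩
    · simpa [hj.symm] using congrFun h j₂
    · ext i
      simp [Matrix.mulVec_sub, h₁, h₂]
      ring

/-- If `y` can replace no entry of `s` without making the determinant vanish, then the column
of `y` is proportional to the column of `u`. -/
theorem exists_proportional_of_det {B : LinearMap.BilinForm K V} {n : ℕ} {w : Fin (n + 1) → V}
    {u y : V} {s : Fin n → V}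
    (hdet : (Matrix.of fun i j => B (Matrix.vecCons u s j) (w i)).det ≠ 0)
    (hy : ∀ l, (Matrix.of fun i j =>
      B (Matrix.vecCons u (Function.update s l y) j) (w i)).det = 0) :
    ∃ μ : K, ∀ i, B y (w i) = μ * B u (w i) := by
  refine eq_smul_col_zero_of_det_updateCol (y := fun i => B y (w i)) hdet fun l => ?_
  rw [← hy l]
  congr 1
  ext i j
  refine Fin.cases ?_ (fun j => ?_) j
  · rw [Matrix.updateCol_ne (Fin.succ_ne_zero l).symm]
    simp
  · by_cases hjl : j = l
    · subst hjl
      simp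
    · rw [Matrix.updateCol_ne (by simpa using hjl)]
      simp [hjl]

theorem map_vecCons_vecCons_eq_zero_iff {k : ℕ} (η : V [⋀^Fin (k + 2)]→ₗ[K] K) (u v : V)
    (s : Fin k → V) :
    η (Matrix.vecCons u (Matrix.vecCons v s)) = 0
      ↔ η (Matrix.vecCons v (Matrix.vecCons u s)) = 0 := by
  rw [map_eq_zero_iff_vecCons η _ 1]
  have : (fun j => Matrix.vecCons u (Matrix.vecCons v s) ((1 : Fin (k + 2)).succAbove j))
      = Matrix.vecCons u s := by
    funext j
    refine Fin.cases ?_ (fun j => ?_) j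
    · simp
    · rw [← Fin.succ_zero_eq_one, Fin.succ_succAbove_succ]
      simp
  rw [this]
  simp

/-! ### Forms that are determinantal at all isotropic vectors -/

/-- For every nonzero isotropic `v`, the form `ω(v, ·)` is given on `v^⊥` by the exterior product
of pairwise orthogonal isotropic vectors of `v^⊥`. -/
def IsDetAtIsotropic (B : LinearMap.BilinForm K V) {n : ℕ} (ω : V [⋀^Fin (n + 1)]→ₗ[K] K) : Prop :=
  ∀ v : V, v ≠ 0 → B v v = 0 → ∃ w : Fin n → V, (∀ i, B v (w i) = 0) ∧
    (∀ i j, B (w i) (w j) = 0) ∧ ∀ r : Fin n → V, (∀ i, B v (r i) = 0) →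
      ω (Matrix.vecCons v r) = (Matrix.of fun i j => B (r j) (w i)).det

/-- A basis of `V` consisting of hyperbolic pairs `(a, b)`, `(e i, f i)` and, in odd dimension, an
anisotropic vector `z`, such that `ω(a, ·)` is given on `a^⊥` by the exterior product of
the `e i`. In even dimension `z = 0`. -/
structure IsFrame (B : LinearMap.BilinForm K V) {n : ℕ} (ω : V [⋀^Fin (n + 1)]→ₗ[K] K)
    (a b z : V) (e f : Fin n → V) : Prop where
  hyp : IsHyperbolic B e f
  aa : B a a = 0
  bb : B b b = 0
  ab : B a b = 1
  az : B a z = 0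
  bz : B b z = 0
  ae : ∀ i, B a (e i) = 0
  af : ∀ i, B a (f i) = 0
  be : ∀ i, B b (e i) = 0
  bf : ∀ i, B b (f i) = 0
  ze : ∀ i, B z (e i) = 0
  zf : ∀ i, B z (f i) = 0
  span_eq_top : hypSpan K e f ⊔ Submodule.span K {z} ⊔ Submodule.span K {b} ⊔
    Submodule.span K {a} = ⊤
  dim : (z = 0 ∧ Module.finrank K V = 2 * (n + 1)) ∨
    (B z z ≠ 0 ∧ Module.finrank K V = 2 * (n + 1) + 1)
  det : ∀ r : Fin n → V, (∀ i, B a (r i) = 0) →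
    ω (Matrix.vecCons a r) = (Matrix.of fun i j => B (r j) (e i)).det

/-- The vectors `w` represent the form `ω(v, ·)`, which is nonzero on `(a, s)`. -/
structure Represents (B : LinearMap.BilinForm K V) {n : ℕ} (ω : V [⋀^Fin (n + 2)]→ₗ[K] K)
    (a : V) (e f : Fin (n + 1) → V) (v : V) (w : Fin (n + 1) → V) (s : Fin n → V) : Prop where
  vw : ∀ i, B v (w i) = 0
  ww : ∀ i j, B (w i) (w j) = 0
  det : ∀ r : Fin (n + 1) → V, (∀ i, B v (r i) = 0) →
    ω (Matrix.vecCons v r) = (Matrix.of fun i j => B (r j) (w i)).det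
  mem : ∀ l, s l ∈ hypSpan K e f
  vs : ∀ l, B v (s l) = 0
  ne_zero : ω (Matrix.vecCons v (Matrix.vecCons a s)) ≠ 0

/-! ### Rigidity: comparing `ω(v, ·)` with `ω(a, ·)` -/

section Frame

variable {B : LinearMap.BilinForm K V} {n : ℕ} {ω : V [⋀^Fin (n + 2)]→ₗ[K] K}
  {a b z : V} {e f : Fin (n + 1) → V}

theorem map_vecCons_eq_zero {m : ℕ} {g : V →ₗ[K] K} {x : V} {s : Fin m → V} (hx : g x = 0)
    (hs : ∀ l, g (s l) = 0) (l : Fin (m + 1)) : g (Matrix.vecCons x s l) = 0 :=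
  Fin.cases hx hs l

theorem map_update_eq_zero {m : ℕ} {g : V →ₗ[K] K} {s : Fin m → V} {l : Fin m} {y : V}
    (hy : g y = 0) (hs : ∀ l, g (s l) = 0) (l' : Fin m) : g (Function.update s l y l') = 0 := by
  by_cases h : l' = l
  · subst h
    simpa using hy
  · rw [Function.update_of_ne h]
    exact hs l'

theorem vecCons_mem {m : ℕ} {U : Submodule K V} {x : V} {s : Fin m → V} (hx : x ∈ U)
    (hs : ∀ l, s l ∈ U) (l : Fin (m + 1)) : Matrix.vecCons x s l ∈ U :=
  Fin.cases hx hs l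

/-- The columns of the `s l` are the unit vectors other than the `i`-th, so the determinant is `± B
v (e i)`. -/
theorem IsHyperbolic.det_ne_zero (hef : IsHyperbolic B e f) {v : V} {i : Fin (n + 1)}
    (hvi : B v (e i) ≠ 0) {s : Fin n → V} {c : Fin n → K}
    (hs : ∀ l, s l = f (i.succAbove l) - c l • e i) :
    (Matrix.of fun i' j => B (Matrix.vecCons v s j) (e i')).det ≠ 0 := by
  intro h
  obtain ⟨g, hg, hgA⟩ := Matrix.exists_vecMul_eq_zero_iff.mpr h
  apply hg
  have h1 : ∀ l : Fin n, g (i.succAbove l) = 0 := by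
    intro l
    have := congrFun hgA l.succ
    simpa [Matrix.vecMul, dotProduct, hs, hef.fe, hef.ee] using this
  have h2 : g i = 0 := by
    have := congrFun hgA 0
    simp only [Matrix.vecMul, dotProduct, Fin.sum_univ_succAbove _ i, h1, zero_mul,
      Finset.sum_const_zero, add_zero, Matrix.of_apply, Matrix.cons_val_zero, Pi.zero_apply] at this
    exact (mul_eq_zero.mp this).resolve_right hvi
  funext i'
  rcases Fin.eq_self_or_eq_succAbove i i' with rfl | ⟨l, rfl⟩
  · exact h2
  · exact h1 l

theorem IsFrame.hypSpan_perp (F : IsFrame B ω a b z e f) {x : V} (hx : x ∈ hypSpan K e f) :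
    B a x = 0 ∧ B b x = 0 ∧ B z x = 0 :=
  ⟨hypSpan_induction (B a) F.ae F.af hx, hypSpan_induction (B b) F.be F.bf hx,
    hypSpan_induction (B z) F.ze F.zf hx⟩

theorem IsFrame.exists_represents (hω : IsDetAtIsotropic B ω)
    (F : IsFrame B ω a b z e f) {v : V} (hvv : B v v = 0) (hav : B a v = 0)
    (hve : ∃ i, B v (e i) ≠ 0) : ∃ w s, Represents B ω a e f v w s := by
  obtain ⟨i, hi⟩ := hve
  have hv : v ≠ 0 := by
    rintro rfl
    simp at hi
  obtain ⟨w, h1, h2, h3⟩ := hω v hv hvv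
  -- Chosen to make `s l` orthogonal to `v`; the multiple of `e i` is invisible to pairings with the
  -- `e`'s.
  let c : Fin n → K := fun l => B v (f (i.succAbove l)) / B v (e i)
  let s : Fin n → V := fun l => f (i.succAbove l) - c l • e i
  have hs : ∀ l, s l ∈ hypSpan K e f := fun l =>
    sub_mem (right_mem_hypSpan e f _) (Submodule.smul_mem _ _ (left_mem_hypSpan e f i))
  refine ⟨w, s, h1, h2, h3, hs, fun l => ?_, ?_⟩
  · simp only [s, c, map_sub, map_smul, smul_eq_mul]
    field_simp
    ring
  · rw [Ne, map_vecCons_vecCons_eq_zero_iff,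
      F.det _ (map_vecCons_eq_zero hav fun l => (F.hypSpan_perp (hs l)).1)]
    exact F.hyp.det_ne_zero hi (c := c) fun l => rfl

/-- `ω(v, a, s)` is a nonzero determinant in the `w i`. Up to sign, `hy` says that replacing any `s
l` by `y` makes it zero, so Cramer's rule leaves only the column of `a`. -/
theorem Represents.exists_proportional {v : V} {w : Fin (n + 1) → V} {s : Fin n → V}
    (R : Represents B ω a e f v w s) (hva : B v a = 0) {y : V} (hvy : B v y = 0)
    (hy : ∀ l, ω (Matrix.vecCons a (Matrix.vecCons v (Function.update s l y))) = 0) :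
    ∃ μ : K, ∀ i, B y (w i) = μ * B a (w i) := by
  refine exists_proportional_of_det (s := s) ?_ fun l => ?_
  · rw [← R.det _ (map_vecCons_eq_zero hva R.vs)]
    exact R.ne_zero
  · rw [← R.det _ (map_vecCons_eq_zero hva (map_update_eq_zero hvy R.vs)),
      map_vecCons_vecCons_eq_zero_iff]
    exact hy l

/-- In the determinant for `ω(a, ·)` the column of `y` is zero. -/
theorem IsFrame.exists_proportional_of_perp (F : IsFrame B ω a b z e f)
    {v : V} {w : Fin (n + 1) → V} {s : Fin n → V} (R : Represents B ω a e f v w s)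
    (hav : B a v = 0) (hva : B v a = 0) {y : V} (hvy : B v y = 0) (hay : B a y = 0)
    (hye : ∀ i, B y (e i) = 0) : ∃ μ : K, ∀ i, B y (w i) = μ * B a (w i) := by
  refine R.exists_proportional hva hvy fun l => ?_
  rw [F.det _ (map_vecCons_eq_zero hav (map_update_eq_zero hay
    fun l => (F.hypSpan_perp (R.mem l)).1))]
  refine Matrix.det_eq_zero_of_column_eq_zero l.succ fun i => ?_
  simp [hye]

/-- `ω` vanishes on tuples containing an isotropic vector `v`, two vectors orthogonal to `a` and
all `e i`, and otherwise vectors orthogonal to `v`. -/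
theorem IsFrame.eq_zero_of_two_perp (hsymm : B.IsSymm) (hω : IsDetAtIsotropic B ω)
    (F : IsFrame B ω a b z e f) {t : Fin (n + 2) → V} (i₀ : Fin (n + 2))
    (hvv : B (t i₀) (t i₀) = 0) (hav : B a (t i₀) = 0) (hve : ∃ i, B (t i₀) (e i) ≠ 0)
    (ht : ∀ i, i ≠ i₀ → B (t i₀) (t i) = 0) (i₁ i₂ : Fin (n + 2)) (h₁ : i₁ ≠ i₀) (h₂ : i₂ ≠ i₀)
    (h₁₂ : i₁ ≠ i₂) (ha₁ : B a (t i₁) = 0) (he₁ : ∀ i, B (t i₁) (e i) = 0)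
    (ha₂ : B a (t i₂) = 0) (he₂ : ∀ i, B (t i₂) (e i) = 0) : ω t = 0 := by
  obtain ⟨w, s, R⟩ := F.exists_represents hω hvv hav hve
  have hva : B (t i₀) a = 0 := (hsymm.eq _ _).trans hav
  obtain ⟨μ₁, hμ₁⟩ := F.exists_proportional_of_perp R hav hva (ht i₁ h₁) ha₁ he₁
  obtain ⟨μ₂, hμ₂⟩ := F.exists_proportional_of_perp R hav hva (ht i₂ h₂) ha₂ he₂
  rw [map_eq_zero_iff_vecCons ω t i₀, R.det _ fun l => ht _ (Fin.succAbove_ne i₀ l)]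
  obtain ⟨j₁, rfl⟩ := Fin.exists_succAbove_eq h₁
  obtain ⟨j₂, rfl⟩ := Fin.exists_succAbove_eq h₂
  exact det_eq_zero_of_col_proportional (fun h => h₁₂ (by rw [h])) hμ₁ hμ₂

end Frame

/-! ### The maximal isotropic subspace attached to `v` -/

section

variable [FiniteDimensional K V] {B : LinearMap.BilinForm K V} {n : ℕ}
  {ω : V [⋀^Fin (n + 2)]→ₗ[K] K} {a b z : V} {e f : Fin (n + 1) → V}

/-- The vectors representing `ω(v, ·)` are orthogonal to `b` and to the `e j` in `v^⊥`, provided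
that `ω(a, b, ·)` and `ω(z, ·)` vanish on the span of the `e i` and `f i`. -/
theorem IsFrame.exists_represents_perp (hK : (2 : K) ≠ 0) (hsymm : B.IsSymm)
    (hnd : B.Nondegenerate) (hω : IsDetAtIsotropic B ω) (F : IsFrame B ω a b z e f)
    (hab : VanishesOn ((ω.curryLeft a).curryLeft b) (hypSpan K e f))
    (hz : VanishesOn (ω.curryLeft z) (hypSpan K e f))
    {v : V} (hv : v ∈ hypSpan K e f) (hvv : B v v = 0) (hve : ∃ i, B v (e i) ≠ 0) :
    ∃ w s, Represents B ω a e f v w s ∧ (∀ i, B b (w i) = 0) ∧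
      ∀ j, B v (e j) = 0 → ∀ i, B (e j) (w i) = 0 := by
  obtain ⟨hav, hbv, hzv⟩ := F.hypSpan_perp hv
  have hva : B v a = 0 := (hsymm.eq _ _).trans hav
  have hvb : B v b = 0 := (hsymm.eq _ _).trans hbv
  have hvz : B v z = 0 := (hsymm.eq _ _).trans hzv
  obtain ⟨w, s, R⟩ := F.exists_represents hω hvv hav hve
  refine ⟨w, s, R, ?_⟩
  have hv0 : v ≠ 0 := by
    rintro rfl
    obtain ⟨i, hi⟩ := hve
    simp at hi
  -- `b` is not orthogonal to `a`, so here the vanishing of `ω(a, b, ·)` takes the place of the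
  -- frame determinant.
  obtain ⟨lam, hlam⟩ : ∃ μ : K, ∀ i, B b (w i) = μ * B a (w i) := by
    refine R.exists_proportional hva hvb fun l => ?_
    have h := map_eq_zero_iff_vecCons (ω.curryLeft a)
      (Matrix.vecCons v (Function.update s l b)) l.succ
    refine h.mpr ?_
    simp only [Matrix.cons_val_succ, Function.update_self]
    refine hab _ fun j => ?_
    rcases Fin.eq_zero_or_eq_succ (l.succ.succAbove j) with h0 | ⟨j', hj'⟩
    · rw [h0]
      exact hv
    · rw [hj', Matrix.cons_val_succ, Function.update_of_ne]
      · exact R.mem j'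
      · rintro rfl
        exact Fin.succAbove_ne _ _ hj'
  obtain ⟨μz, hμz⟩ := F.exists_proportional_of_perp R hav hva hvz F.az F.ze
  -- The column of `z - μz • a` is zero, so `ω(v, z, s) = μz ω(v, a, s)`. The left side vanishes by
  -- `hz`, and `ω(v, a, s) ≠ 0` forces `μz = 0`.
  have hzw : ∀ i, B z (w i) = 0 := by
    have h1 : ω (Matrix.vecCons v (Matrix.vecCons (z - μz • a) s)) = 0 := by
      rw [R.det _ (map_vecCons_eq_zero (by simp [hvz, hva]) R.vs)]
      exact Matrix.det_eq_zero_of_column_eq_zero 0 fun i => by simp [hμz]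
    have h2 : ω (Matrix.vecCons v (Matrix.vecCons z s)) = 0 := by
      rw [map_vecCons_vecCons_eq_zero_iff]
      exact hz _ (vecCons_mem hv R.mem)
    have h3 : ω (Matrix.vecCons v (Matrix.vecCons (z - μz • a) s))
        = ω (Matrix.vecCons v (Matrix.vecCons z s))
          - μz * ω (Matrix.vecCons v (Matrix.vecCons a s)) := by
      have := congrArg (fun g : V [⋀^Fin n]→ₗ[K] K => g s)
        (map_sub (ω.curryLeft v).curryLeft z (μz • a))
      rw [map_smul] at this
      exact this
    rw [h1, h2, zero_sub, eq_comm, neg_eq_zero] at h3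
    have h4 := (mul_eq_zero.mp h3).resolve_right R.ne_zero
    intro i
    rw [hμz, h4, zero_mul]
  have hli : LinearIndependent K (Matrix.vecCons v w) := by
    refine linearIndependent_vecCons_of_det_ne_zero hsymm hv0 (r := Matrix.vecCons a s)
      (map_vecCons_eq_zero hva R.vs) ?_
    rw [← R.det _ (map_vecCons_eq_zero hva R.vs)]
    exact R.ne_zero
  let L : Submodule K V := Submodule.span K (Set.range (Matrix.vecCons v w))
  have hLle : ∀ x : V, B x v = 0 → (∀ i, B x (w i) = 0) → ∀ y ∈ L, B x y = 0 := by
    intro x hxv hxw y hy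
    have : L ≤ LinearMap.ker (B x) := by
      refine Submodule.span_le.mpr ?_
      rintro _ ⟨l, rfl⟩
      exact map_vecCons_eq_zero hxv hxw l
    exact this hy
  have hvL : v ∈ L := Submodule.subset_span ⟨0, rfl⟩
  have hwL : ∀ i, w i ∈ L := fun i => Submodule.subset_span ⟨i.succ, rfl⟩
  have hmem : ∀ x : V, (∀ y ∈ L, B x y = 0) → x ∈ B.orthogonal L := by
    intro x hx
    rw [LinearMap.BilinForm.mem_orthogonal_iff]
    exact fun y hy => (hsymm.eq _ _).trans (hx y hy)
  have hLL : L ≤ B.orthogonal L := by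
    intro x hx
    refine hmem x fun y hy => ?_
    refine (hsymm.eq _ _).trans (hLle y ?_ ?_ x hx)
    · exact (hsymm.eq _ _).trans (hLle v hvv R.vw y hy)
    · exact fun i => (hsymm.eq _ _).trans
        (hLle (w i) ((hsymm.eq _ _).trans (R.vw i)) (R.ww i) y hy)
  have hfrL : Module.finrank K L = n + 2 := by
    rw [finrank_span_eq_card hli, Fintype.card_fin]
  have hzL : ∀ y ∈ L, B z y = 0 := hLle z hzv hzw
  -- `L` is isotropic of the maximal dimension `n + 2`, so its orthogonal exceeds it by at most the
  -- line of `z`.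
  have horth : L ⊔ Submodule.span K {z} = B.orthogonal L := by
    have hle : L ⊔ Submodule.span K {z} ≤ B.orthogonal L :=
      sup_le hLL ((Submodule.span_singleton_le_iff_mem _ _).mpr (hmem z hzL))
    refine Submodule.eq_of_le_of_finrank_le hle ?_
    rw [LinearMap.BilinForm.finrank_orthogonal hnd, hfrL]
    rcases F.dim with ⟨rfl, hd⟩ | ⟨hzz, hd⟩
    · rw [Submodule.span_zero_singleton, sup_bot_eq, hfrL]
      omega
    · have hlt : L < L ⊔ Submodule.span K {z} := by
        refine lt_of_le_of_ne le_sup_left fun heq => hzz (hzL z ?_)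
        rw [heq]
        exact Submodule.mem_sup_right (Submodule.mem_span_singleton_self z)
      have := Submodule.finrank_lt_finrank_of_lt hlt
      omega
  have hbL : b - lam • a ∈ L := by
    have h1 : b - lam • a ∈ L ⊔ Submodule.span K {z} := by
      rw [horth]
      exact hmem _ (hLle _ (by simp [hbv, hav]) fun i => by simp [hlam])
    obtain ⟨l, hl, z', hz', h2⟩ := Submodule.mem_sup.mp h1
    obtain ⟨c, rfl⟩ := Submodule.mem_span_singleton.mp hz'
    have hcz : c • z = 0 := by
      rcases F.dim with ⟨rfl, -⟩ | ⟨hzz, -⟩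
      · exact smul_zero c
      · have h3 := congrArg (B z) h2
        have hza : B z a = 0 := (hsymm.eq _ _).trans F.az
        have hzb : B z b = 0 := (hsymm.eq _ _).trans F.bz
        simp only [map_add, map_sub, map_smul, hzL l hl, hza, hzb, smul_eq_mul, mul_zero, sub_zero,
          zero_add] at h3
        rw [(mul_eq_zero.mp h3).resolve_right hzz, zero_smul]
    rw [← h2, hcz, add_zero]
    exact hl
  have hba : B b a = 1 := (hsymm.eq _ _).trans F.ab
  -- `b - lam • a` lies in the isotropic space `L`, and its square is `-2 lam`.
  have hlam0 : lam = 0 := by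
    have h1 := LinearMap.BilinForm.mem_orthogonal_iff.mp (hLL hbL) _ hbL
    have h2 : B (b - lam • a) (b - lam • a) = 0 := h1
    simp only [map_sub, map_smul, LinearMap.sub_apply, LinearMap.smul_apply, smul_eq_mul, F.bb,
      F.aa, F.ab, hba] at h2
    refine (mul_eq_zero.mp (?_ : (2 : K) * lam = 0)).resolve_left hK
    linear_combination -h2
  rw [hlam0, zero_smul, sub_zero] at hbL
  refine ⟨fun i => by rw [hlam, hlam0, zero_mul], fun j hj i => ?_⟩
  -- `e j - μ • a` is orthogonal to `L`, which contains `b`; pairing with `b` gives `μ = 0`.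
  obtain ⟨μ, hμ⟩ := F.exists_proportional_of_perp R hav hva hj (F.ae j) (F.hyp.ee j)
  have h1 := hLle (e j - μ • a) (by simp [hav, (hsymm.eq (e j) v).trans hj])
    (fun i => by simp [hμ]) b hbL
  have heb : B (e j) b = 0 := (hsymm.eq _ _).trans (F.be j)
  simp only [map_sub, map_smul, LinearMap.sub_apply, LinearMap.smul_apply, smul_eq_mul, heb, F.ab,
    zero_sub, mul_one, neg_eq_zero] at h1
  rw [hμ, h1, zero_mul]

end

/-! ### Reconstruction of the form from a normalized frame -/

theorem map_vecCons_eq_zero_of_ne {m : ℕ} {g : V →ₗ[K] K} {x : V} {s : Fin m → V} {i₀ : Fin m}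
    (hx : g x = 0) (hs : ∀ l, l ≠ i₀ → g (s l) = 0) (l : Fin (m + 1)) (hl : l ≠ i₀.succ) :
    g (Matrix.vecCons x s l) = 0 := by
  induction l using Fin.cases with
  | zero => exact hx
  | succ l => exact hs l fun h => hl (by rw [h])

/-- Makes the exceptional monomials of the weak criterion void in degree above two. -/
theorem card_le_two_of_pair {κ : Type*} {k : ℕ} {t : Fin k → κ ⊕ κ} (ht : Function.Injective t)
    {j : κ} (hj : ∀ l, t l = Sum.inl j ∨ t l = Sum.inr j) : k ≤ 2 := by
  have : Function.Injective fun l => (t l).isLeft := by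
    intro l l' h
    apply ht
    rcases hj l with h1 | h1 <;> rcases hj l' with h2 | h2 <;> simp_all
  simpa using Fintype.card_le_of_injective _ this

theorem slots_eq_zero_of_vanishesOn {k : ℕ} {η : V [⋀^Fin (k + 1)]→ₗ[K] K} {U : Submodule K V}
    {z u : V} (hz : VanishesOn (η.curryLeft z) U) {x : Fin (k + 1) → V} {m m' : Fin (k + 1)}
    (h : m ≠ m') (hx : ∀ l, x l ∈ U) (hu : u ∈ U) : slots η x h u z = 0 := by
  rw [slots_apply, map_eq_zero_iff_vecCons η _ m', Function.update_self]
  refine hz _ fun l => ?_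
  rw [Function.update_of_ne (Fin.succAbove_ne _ _)]
  by_cases hl : m'.succAbove l = m
  · simpa [hl] using hu
  · rw [Function.update_of_ne hl]
    exact hx _

section Normalized

variable {B : LinearMap.BilinForm K V} {m : ℕ}
  {ω : V [⋀^Fin (m + 4)]→ₗ[K] K} {a b z : V} {e f : Fin (m + 3) → V}

/-- Here `a` and `z` are the two vectors with proportional columns, so the strong criterion applies.
-/
theorem IsFrame.vanishesOn_abz (hK : (2 : K) ≠ 0) (hsymm : B.IsSymm) (hω : IsDetAtIsotropic B ω)
    (F : IsFrame B ω a b z e f) :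
    VanishesOn (((ω.curryLeft a).curryLeft b).curryLeft z) (hypSpan K e f) := by
  refine VanishesAtIsotropic.vanishesOn (c := True) hK F.hyp ?_ (by simp) (by simp)
    (by simp only [Fintype.card_fin]; omega) (Or.inl trivial) (Or.inl trivial)
  intro s hs i₀ hvv hve hperp _
  obtain ⟨hav, hbv, hzv⟩ := F.hypSpan_perp (hs i₀)
  exact F.eq_zero_of_two_perp hsymm hω
    (t := Matrix.vecCons a (Matrix.vecCons b (Matrix.vecCons z s))) i₀.succ.succ.succ hvv hav hve
    (map_vecCons_eq_zero_of_ne ((hsymm.eq _ _).trans hav) (map_vecCons_eq_zero_of_ne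
      ((hsymm.eq _ _).trans hbv) (map_vecCons_eq_zero_of_ne ((hsymm.eq _ _).trans hzv) hperp)))
    0 (Fin.succ (Fin.succ 0)) (Fin.succ_ne_zero _).symm
    (fun h => Fin.succ_ne_zero _ (Fin.succ_injective _ (Fin.succ_injective _ h)).symm)
    (Fin.succ_ne_zero _).symm F.aa F.ae F.az F.ze

/-- Now the two vectors with proportional columns are `a` and some `e j`, so only the weak criterion
is available; `hf` covers the monomials in the `f i`. -/
theorem IsFrame.vanishesOn_ab (hK : (2 : K) ≠ 0) (hsymm : B.IsSymm) (hω : IsDetAtIsotropic B ω)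
    (F : IsFrame B ω a b z e f) (hdim : 8 < Module.finrank K V)
    (hf : ∀ t : Fin (m + 2) → Fin (m + 3),
      ω (Matrix.vecCons a (Matrix.vecCons b fun l => f (t l))) = 0) :
    VanishesOn ((ω.curryLeft a).curryLeft b) (hypSpan K e f) := by
  refine VanishesAtIsotropic.vanishesOn (c := False) hK F.hyp ?_ (by simp) (by simp)
    (by simp only [Fintype.card_fin]; omega) (Or.inr fun t _ => hf t) (Or.inr ?_)
  · rintro s hs i₀ hvv hve hperp (h | ⟨i, hi, j, hj⟩)
    · exact h.elim
    obtain ⟨hav, hbv, -⟩ := F.hypSpan_perp (hs i₀)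
    refine F.eq_zero_of_two_perp hsymm hω
      (t := Matrix.vecCons a (Matrix.vecCons b s)) i₀.succ.succ hvv hav hve
      (map_vecCons_eq_zero_of_ne ((hsymm.eq _ _).trans hav) (map_vecCons_eq_zero_of_ne
        ((hsymm.eq _ _).trans hbv) hperp))
      0 i.succ.succ (Fin.succ_ne_zero _).symm (by simpa using hi)
      (Fin.succ_ne_zero _).symm F.aa F.ae ?_ ?_
    · simpa [hj] using F.ae j
    · simpa [hj] using F.hyp.ee j
  intro t ht j hj
  have hm := card_le_two_of_pair ht hj
  -- The exceptional monomial `{e j, f j}` has degree `m + 2`, so `m = 0` and the dimension is 8 or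
  -- 9. Dimension 8 is excluded by `hdim`; in dimension 9 the anisotropic `z` helps.
  rcases F.dim with ⟨-, hd⟩ | ⟨hzz, -⟩
  · omega
  have h01 : (0 : Fin (m + 2)) ≠ 1 := by simp
  have hl : ∀ l : Fin (m + 2), l ≠ 0 → l ≠ 1 → False := by
    intro l h0 h1
    have h0' : (l : ℕ) ≠ 0 := fun h => h0 (Fin.ext h)
    have h1' : (l : ℕ) ≠ 1 := fun h => h1 (Fin.ext (by simp [h]))
    omega
  let x : Fin (m + 2) → V := fun l => Sum.elim e f (t l)
  let S := slots ((ω.curryLeft a).curryLeft b) x h01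
  have hx : ∀ l, x l ∈ hypSpan K e f := fun l => Submodule.subset_span ⟨t l, rfl⟩
  have hSz : ∀ u ∈ hypSpan K e f, S u z = 0 := fun u hu =>
    slots_eq_zero_of_vanishesOn (F.vanishesOn_abz hK hsymm hω) h01 hx hu
  have hzS : ∀ u ∈ hypSpan K e f, S z u = 0 := fun u hu => by
    have := slots_swap ((ω.curryLeft a).curryLeft b) x h01 z u
    exact this.trans (by rw [neg_eq_zero]; exact hSz u hu)
  have hfe : S (f j) (e j) = 0 := by
    -- An isotropic vector outside the hyperbolic span. `r` is orthogonal to `v`, `a` and all `e i`,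
    -- so `S v r = 0`; the terms mixing `z` with `e j` or `f j` vanish, leaving `-B z z * S (f j) (e
    -- j)`.
    let v : V := f j + z - (B z z / 2) • e j
    let r : V := z - B z z • e j
    have hza : B z a = 0 := (hsymm.eq _ _).trans F.az
    have hzb : B z b = 0 := (hsymm.eq _ _).trans F.bz
    have hea : ∀ j, B (e j) a = 0 := fun j => (hsymm.eq _ _).trans (F.ae j)
    have hfa : ∀ j, B (f j) a = 0 := fun j => (hsymm.eq _ _).trans (F.af j)
    have heb : ∀ j, B (e j) b = 0 := fun j => (hsymm.eq _ _).trans (F.be j)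
    have hfb : ∀ j, B (f j) b = 0 := fun j => (hsymm.eq _ _).trans (F.bf j)
    have hez : ∀ j, B (e j) z = 0 := fun j => (hsymm.eq _ _).trans (F.ze j)
    have hfz : ∀ j, B (f j) z = 0 := fun j => (hsymm.eq _ _).trans (F.zf j)
    have hvv : B v v = 0 := by
      simp [v, F.hyp.ff, F.hyp.ee, F.hyp.ef, F.hyp.fe, hez, hfz, F.ze, F.zf]
      field_simp
      ring
    have hve : B v (e j) ≠ 0 := by
      simp [v, F.hyp.ee, F.hyp.fe, F.ze]
    have hvr : B v r = 0 := by
      simp [v, r, F.hyp.ee, F.hyp.fe, hez, hfz, F.ze]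
    have key : S v r = 0 := by
      have hu0 : Function.update (Function.update x 0 v) 1 r 0 = v := by simp
      have hu1 : Function.update (Function.update x 0 v) 1 r 1 = r := by simp
      refine F.eq_zero_of_two_perp hsymm hω (t := Matrix.vecCons a (Matrix.vecCons b
        (Function.update (Function.update x 0 v) 1 r))) (Fin.succ (Fin.succ 0)) ?_ ?_ ?_ ?_
        0 (Fin.succ (Fin.succ 1)) (Fin.succ_ne_zero _).symm
        (fun h => h01.symm (Fin.succ_injective _ (Fin.succ_injective _ h)))
        (Fin.succ_ne_zero _).symm F.aa F.ae ?_ ?_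
      · simpa only [Matrix.cons_val_succ, hu0] using hvv
      · simp only [Matrix.cons_val_succ, hu0]
        simp [v, F.af, F.ae, F.az]
      · simp only [Matrix.cons_val_succ, hu0]
        exact ⟨j, hve⟩
      · simp only [Matrix.cons_val_succ, hu0]
        refine map_vecCons_eq_zero_of_ne ?_ (map_vecCons_eq_zero_of_ne ?_ fun l hl0 => ?_)
        · simp [v, hfa, hea, hza]
        · simp [v, hfb, heb, hzb]
        · by_cases hl1 : l = 1
          · rw [hl1, hu1]
            exact hvr
          · exact (hl l hl0 hl1).elim
      · simp only [Matrix.cons_val_succ, hu1]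
        simp [r, F.ae, F.az]
      · simp only [Matrix.cons_val_succ, hu1]
        simp [r, F.hyp.ee, F.ze]
    have hee : S (e j) (e j) = 0 := slots_self _ _ _ _
    have hzz' : S z z = 0 := slots_self _ _ _ _
    simp only [v, r, map_add, map_sub, map_smul, LinearMap.add_apply, LinearMap.sub_apply,
      LinearMap.smul_apply, smul_eq_mul, hee, hzz', hSz _ (left_mem_hypSpan e f j),
      hSz _ (right_mem_hypSpan e f j), hzS _ (left_mem_hypSpan e f j)] at key
    refine (mul_eq_zero.mp (?_ : B z z * S (f j) (e j) = 0)).resolve_left hzz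
    linear_combination -key
  have hef : S (e j) (f j) = 0 := by
    have := slots_swap ((ω.curryLeft a).curryLeft b) x h01 (e j) (f j)
    exact this.trans (by rw [neg_eq_zero]; exact hfe)
  have h01t : t 0 ≠ t 1 := fun h => h01 (ht h)
  have hS : S (x 0) (x 1) = ((ω.curryLeft a).curryLeft b) x := slots_eq _ x h01
  change ((ω.curryLeft a).curryLeft b) x = 0
  rw [← hS]
  rcases hj 0 with h0 | h0 <;> rcases hj 1 with h1 | h1
  · exact absurd (h0.trans h1.symm) h01t
  · simpa [x, h0, h1] using hef
  · simpa [x, h0, h1] using hfe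
  · exact absurd (h0.trans h1.symm) h01t

theorem IsFrame.vanishesOn_z (hK : (2 : K) ≠ 0) (hsymm : B.IsSymm) (hω : IsDetAtIsotropic B ω)
    (F : IsFrame B ω a b z e f) (hf : ω (Matrix.vecCons z f) = 0) :
    VanishesOn (ω.curryLeft z) (hypSpan K e f) := by
  refine VanishesAtIsotropic.vanishesOn (c := False) hK F.hyp ?_ (by simp) (by simp)
    (by simp only [Fintype.card_fin]; omega) (Or.inr fun t ht => ?_) (Or.inr ?_)
  · rintro s hs i₀ hvv hve hperp (h | ⟨i, hi, j, hj⟩)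
    · exact h.elim
    obtain ⟨hav, -, hzv⟩ := F.hypSpan_perp (hs i₀)
    refine F.eq_zero_of_two_perp hsymm hω (t := Matrix.vecCons z s) i₀.succ hvv hav hve
      (map_vecCons_eq_zero_of_ne ((hsymm.eq _ _).trans hzv) hperp)
      0 i.succ (Fin.succ_ne_zero _).symm (by simpa using hi)
      (Fin.succ_ne_zero _).symm F.az F.ze ?_ ?_
    · simpa [hj] using F.ae j
    · simpa [hj] using F.hyp.ee j
  -- The degree equals the number of `f i`, so up to sign there is only one monomial in them.
  · have h := (ω.curryLeft z).map_perm f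
      (Equiv.ofBijective t (Finite.injective_iff_bijective.mp ht))
    have h0 : ω.curryLeft z f = 0 := hf
    rw [h0, smul_zero] at h
    exact h
  · intro t ht j hj
    have := card_le_two_of_pair ht hj
    omega

variable [FiniteDimensional K V]

/-- A single entry `b` or `e j` now suffices, because its column is zero and not merely proportional
to that of `a`. -/
theorem IsFrame.eq_zero_of_perp (hK : (2 : K) ≠ 0) (hsymm : B.IsSymm)
    (hnd : B.Nondegenerate) (hω : IsDetAtIsotropic B ω) (F : IsFrame B ω a b z e f)
    (hab : VanishesOn ((ω.curryLeft a).curryLeft b) (hypSpan K e f))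
    (hz : VanishesOn (ω.curryLeft z) (hypSpan K e f))
    {t : Fin (m + 4) → V} (i₀ : Fin (m + 4)) (hv : t i₀ ∈ hypSpan K e f)
    (hvv : B (t i₀) (t i₀) = 0) (hve : ∃ i, B (t i₀) (e i) ≠ 0)
    (ht : ∀ i, i ≠ i₀ → B (t i₀) (t i) = 0) (i₁ : Fin (m + 4)) (h₁ : i₁ ≠ i₀)
    (hi₁ : t i₁ = b ∨ ∃ j, t i₁ = e j) : ω t = 0 := by
  obtain ⟨w, s, R, hb, he⟩ := F.exists_represents_perp hK hsymm hnd hω hab hz hv hvv hve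
  rw [map_eq_zero_iff_vecCons ω t i₀, R.det _ fun l => ht _ (Fin.succAbove_ne i₀ l)]
  obtain ⟨j₁, rfl⟩ := Fin.exists_succAbove_eq h₁
  refine Matrix.det_eq_zero_of_column_eq_zero j₁ fun i => ?_
  rw [Matrix.of_apply]
  have := ht _ h₁
  rcases hi₁ with h | ⟨j, h⟩
  · rw [h]
    exact hb i
  · rw [h] at this ⊢
    exact he j this i

/-- In a suitably normalized frame, `ω` is the form of `b ∧ e₁ ∧ e₂ ∧ ⋯`. -/
theorem IsFrame.eq_toForm (hK : (2 : K) ≠ 0) (hsymm : B.IsSymm)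
    (hnd : B.Nondegenerate) (hω : IsDetAtIsotropic B ω) (F : IsFrame B ω a b z e f)
    (hdim : 8 < Module.finrank K V)
    (hf : ∀ t : Fin (m + 2) → Fin (m + 3),
      ω (Matrix.vecCons a (Matrix.vecCons b fun l => f (t l))) = 0)
    (hzf : ω (Matrix.vecCons z f) = 0) :
    ω = toForm B (m + 4) (exteriorPower.ιMulti K (m + 4) (Matrix.vecCons b e)) := by
  have hab := F.vanishesOn_ab hK hsymm hω hdim hf
  have hz := F.vanishesOn_z hK hsymm hω hzf
  have habz := F.vanishesOn_abz hK hsymm hω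
  have hbz : VanishesOn ((ω.curryLeft b).curryLeft z) (hypSpan K e f) := by
    refine VanishesAtIsotropic.vanishesOn (c := True) hK F.hyp ?_ (by simp) (by simp)
      (by simp only [Fintype.card_fin]; omega) (Or.inl trivial) (Or.inl trivial)
    intro s hs i₀ hvv hve hperp _
    obtain ⟨-, hbv, hzv⟩ := F.hypSpan_perp (hs i₀)
    exact F.eq_zero_of_perp hK hsymm hnd hω hab hz
      (t := Matrix.vecCons b (Matrix.vecCons z s)) i₀.succ.succ (hs i₀) hvv hve
      (map_vecCons_eq_zero_of_ne ((hsymm.eq _ _).trans hbv) (map_vecCons_eq_zero_of_ne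
        ((hsymm.eq _ _).trans hzv) hperp)) 0 (Fin.succ_ne_zero _).symm (Or.inl rfl)
  have hb : VanishesOn (ω.curryLeft b) (hypSpan K e f) := by
    refine VanishesAtIsotropic.vanishesOn (c := True) hK F.hyp ?_ (by simp) (by simp)
      (by simp only [Fintype.card_fin]; omega) (Or.inl trivial) (Or.inl trivial)
    intro s hs i₀ hvv hve hperp _
    obtain ⟨-, hbv, -⟩ := F.hypSpan_perp (hs i₀)
    exact F.eq_zero_of_perp hK hsymm hnd hω hab hz
      (t := Matrix.vecCons b s) i₀.succ (hs i₀) hvv hve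
      (map_vecCons_eq_zero_of_ne ((hsymm.eq _ _).trans hbv) hperp) 0 (Fin.succ_ne_zero _).symm
      (Or.inl rfl)
  have h0 : VanishesOn ω (hypSpan K e f) := by
    refine VanishesAtIsotropic.vanishesOn (c := False) hK F.hyp ?_ (by simp) (by simp)
      (by simp only [Fintype.card_fin]; omega) (Or.inr fun t ht => ?_) (Or.inr fun t ht j hj => ?_)
    · rintro s hs i₀ hvv hve hperp (h | ⟨i, hi, hj⟩)
      · exact h.elim
      · exact F.eq_zero_of_perp hK hsymm hnd hω hab hz i₀ (hs i₀) hvv hve hperp i hi (Or.inr hj)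
    -- There are more slots than vectors `f i`.
    · have := Fintype.card_le_of_injective t ht
      simp at this
    · have := card_le_two_of_pair ht hj
      omega
  let U := hypSpan K e f ⊔ Submodule.span K {z}
  have hU : ∀ x ∈ U, B a x = 0 ∧ B b x = 0 := by
    intro x hx
    obtain ⟨y, hy, y', hy', rfl⟩ := Submodule.mem_sup.mp hx
    obtain ⟨c, rfl⟩ := Submodule.mem_span_singleton.mp hy'
    obtain ⟨h1, h2, -⟩ := F.hypSpan_perp hy
    simp [h1, h2, F.az, F.bz]
  have hωU : VanishesOn ω U := h0.sup_span_singleton hz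
  have hbU : VanishesOn (ω.curryLeft b) U := hb.sup_span_singleton hbz
  have habU : VanishesOn ((ω.curryLeft a).curryLeft b) U := hab.sup_span_singleton habz
  set θ := toForm B (m + 4) (exteriorPower.ιMulti K (m + 4) (Matrix.vecCons b e)) with hθ
  have hθdet : ∀ r, θ r = (Matrix.of fun i j => B (r j) (Matrix.vecCons b e i)).det :=
    toForm_ιMulti B (m + 4) (Matrix.vecCons b e)
  have hθ0 : ∀ r, (∀ j, B b (r j) = 0) → θ r = 0 := by
    intro r hr
    rw [hθdet]
    exact Matrix.det_eq_zero_of_row_eq_zero 0 fun j => (hsymm.eq _ _).trans (hr j)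
  -- The four cases are tuples without `a` and `b`, with `b` only, with `a` only, and with both.
  -- Only the third has nonzero values, and there both forms are the determinant of the `e i`.
  have hmain : VanishesOn (ω - θ) (U ⊔ Submodule.span K {b} ⊔ Submodule.span K {a}) := by
    refine VanishesOn.sup_span_singleton (VanishesOn.sup_span_singleton ?_ ?_)
      (VanishesOn.sup_span_singleton ?_ ?_)
    · intro t ht
      rw [AlternatingMap.sub_apply, hωU t ht, hθ0 t fun j => (hU _ (ht j)).2, sub_zero]
    · intro t ht
      change ω.curryLeft b t - θ (Matrix.vecCons b t) = 0
      rw [hbU t ht, hθ0 _ (map_vecCons_eq_zero F.bb fun j => (hU _ (ht j)).2), sub_zero]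
    · intro t ht
      change ω (Matrix.vecCons a t) - θ (Matrix.vecCons a t) = 0
      have hexp : θ (Matrix.vecCons a t) = (Matrix.of fun i j => B (t j) (e i)).det := by
        rw [hθdet, Matrix.det_succ_column_zero, Fin.sum_univ_succ,
          Finset.sum_eq_zero fun i _ => by simp [F.ae]]
        simp only [Fin.val_zero, pow_zero, Matrix.of_apply, Matrix.cons_val_zero, F.ab, one_mul,
          add_zero]
        rfl
      rw [F.det t fun j => (hU _ (ht j)).1, hexp, sub_self]
    · intro t ht
      change (ω.curryLeft a).curryLeft b t - θ (Matrix.vecCons a (Matrix.vecCons b t)) = 0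
      rw [habU t ht, hθdet, Matrix.det_eq_zero_of_column_eq_zero 1, sub_zero]
      exact Fin.cases F.bb F.be
  have htop : U ⊔ Submodule.span K {b} ⊔ Submodule.span K {a} = ⊤ := F.span_eq_top
  rw [htop] at hmain
  rw [← sub_eq_zero]
  ext t
  exact hmain t fun _ => Submodule.mem_top

end Normalized

/-! ### Existence of normalized frames -/

section Normalization

variable {B : LinearMap.BilinForm K V} {n : ℕ} {ω : V [⋀^Fin (n + 2)]→ₗ[K] K}
  {a b z : V} {e f : Fin (n + 1) → V}

theorem span_frame_eq_top_of_le {n : ℕ} {a b z a' b' z' : V} {e f e' f' : Fin n → V}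
    (h : hypSpan K e f ⊔ Submodule.span K {z} ⊔ Submodule.span K {b} ⊔
      Submodule.span K {a} = ⊤)
    (h' : ∀ S : Submodule K V, a' ∈ S → b' ∈ S → z' ∈ S → (∀ i, e' i ∈ S) → (∀ i, f' i ∈ S) →
      a ∈ S ∧ b ∈ S ∧ z ∈ S ∧ (∀ i, e i ∈ S) ∧ ∀ i, f i ∈ S) :
    hypSpan K e' f' ⊔ Submodule.span K {z'} ⊔ Submodule.span K {b'} ⊔
      Submodule.span K {a'} = ⊤ := by
  obtain ⟨ha, hb, hz, he, hf⟩ := h' (hypSpan K e' f' ⊔ Submodule.span K {z'} ⊔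
      Submodule.span K {b'} ⊔ Submodule.span K {a'})
    (Submodule.mem_sup_right (Submodule.mem_span_singleton_self _))
    (Submodule.mem_sup_left (Submodule.mem_sup_right (Submodule.mem_span_singleton_self _)))
    (Submodule.mem_sup_left (Submodule.mem_sup_left (Submodule.mem_sup_right
      (Submodule.mem_span_singleton_self _))))
    (fun i => Submodule.mem_sup_left (Submodule.mem_sup_left (Submodule.mem_sup_left
      (left_mem_hypSpan _ _ i))))
    (fun i => Submodule.mem_sup_left (Submodule.mem_sup_left (Submodule.mem_sup_left
      (right_mem_hypSpan _ _ i))))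
  rw [eq_top_iff, ← h]
  refine sup_le (sup_le (sup_le (Submodule.span_le.mpr ?_) ?_) ?_) ?_
  · rintro _ ⟨i | i, rfl⟩
    · exact he i
    · exact hf i
  all_goals rwa [Submodule.span_singleton_le_iff_mem]

/-- A frame can be changed so that `ω(z, f₁, f₂, …) = 0`. -/
theorem IsFrame.exists_normalized_right (hK : (2 : K) ≠ 0) (hsymm : B.IsSymm)
    (F : IsFrame B ω a b z e f) :
    ∃ b' z', IsFrame B ω a b' z' e f ∧ ω (Matrix.vecCons z' f) = 0 := by
  rcases F.dim with ⟨rfl, -⟩ | ⟨hzz, hd⟩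
  · exact ⟨b, 0, F, ω.map_coord_zero 0 rfl⟩
  have haf : ω (Matrix.vecCons a f) = 1 := by
    rw [F.det f F.af, ← Matrix.det_one (n := Fin (n + 1))]
    congr 1
    ext i j
    simp [F.hyp.fe, Matrix.one_apply, eq_comm]
  have hba : B b a = 1 := (hsymm.eq _ _).trans F.ab
  have hza : B z a = 0 := (hsymm.eq _ _).trans F.az
  have hzb : B z b = 0 := (hsymm.eq _ _).trans F.bz
  -- `b'` and `z'` are the images of `b` and `z` under the Eichler isometry that fixes `a` and all
  -- `e i`, `f i`. As `ω(a, f) = 1`, this `c` gives `ω(z', f) = 0`.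
  let c : K := ω (Matrix.vecCons z f) / B z z
  let b' : V := b + c • z - (c ^ 2 * B z z / 2) • a
  let z' : V := z - (c * B z z) • a
  refine ⟨b', z', ⟨F.hyp, F.aa, ?_, ?_, ?_, ?_, F.ae, F.af, ?_, ?_, ?_, ?_, ?_, Or.inr ⟨?_, hd⟩,
    F.det⟩, ?_⟩
  · simp [b', F.bb, F.aa, F.ab, F.az, F.bz, hba, hza, hzb]
    field_simp
    ring
  · simp [b', F.aa, F.ab, F.az]
  · simp [z', F.az, F.aa]
  · simp [b', z', F.aa, F.az, F.bz, hba, hza]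
  · simp [b', F.be, F.ze, F.ae]
  · simp [b', F.bf, F.zf, F.af]
  · simp [z', F.ze, F.ae]
  · simp [z', F.zf, F.af]
  · refine span_frame_eq_top_of_le F.span_eq_top fun S ha hb hz he hf => ?_
    have hz1 : z ∈ S := by
      have : z = z' + (c * B z z) • a := by simp [z']
      rw [this]
      exact add_mem hz (S.smul_mem _ ha)
    have hb1 : b ∈ S := by
      have : b = b' - c • z + (c ^ 2 * B z z / 2) • a := by
        simp only [b']
        abel
      rw [this]
      exact add_mem (sub_mem hb (S.smul_mem _ hz1)) (S.smul_mem _ ha)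
    exact ⟨ha, hb1, hz1, he, hf⟩
  · simpa [z', F.az, F.aa, hza] using hzz
  · have h := congrArg (fun g : V [⋀^Fin (n + 1)]→ₗ[K] K => g f)
      (map_sub ω.curryLeft z ((c * B z z) • a))
    rw [map_smul] at h
    have h' : ω (Matrix.vecCons z' f)
        = ω (Matrix.vecCons z f) - (c * B z z) * ω (Matrix.vecCons a f) := h
    rw [h', haf]
    simp [c, hzz]

/-- A frame can be changed so that `ω(a, b, ·)` vanishes on the `f i`. -/
theorem IsFrame.exists_normalized_left (hsymm : B.IsSymm) (F : IsFrame B ω a b z e f) :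
    ∃ b' e', IsFrame B ω a b' z e' f ∧ ∀ t : Fin n → Fin (n + 1),
      ω (Matrix.vecCons a (Matrix.vecCons b' fun l => f (t l))) = 0 := by
  let D : Fin (n + 1) → K := fun j =>
    ω (Matrix.vecCons a (Matrix.vecCons (f j) fun l => f (j.succAbove l)))
  have hD : ∀ j, D j ≠ 0 := by
    intro j
    simp only [D]
    rw [F.det _ (map_vecCons_eq_zero (F.af j) fun l => F.af _)]
    exact F.hyp.det_ne_zero (i := j) (c := fun _ => 0) (by simp [F.hyp.fe]) (by simp)
  -- In `ω(a, b', ·)` on the `f`'s other than `f j`, only the term `c j • f j` of the correction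
  -- survives, contributing `c j * D j`. Replacing `e j` by `e j - c j • a` restores orthogonality
  -- to `b'` and changes no pairing with `a^⊥`.
  let c : Fin (n + 1) → K := fun j =>
    - ω (Matrix.vecCons a (Matrix.vecCons b fun l => f (j.succAbove l))) / D j
  have hba : B b a = 1 := (hsymm.eq _ _).trans F.ab
  have hea : ∀ j, B (e j) a = 0 := fun j => (hsymm.eq _ _).trans (F.ae j)
  have hfa : ∀ j, B (f j) a = 0 := fun j => (hsymm.eq _ _).trans (F.af j)
  have hfb : ∀ j, B (f j) b = 0 := fun j => (hsymm.eq _ _).trans (F.bf j)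
  have hfz : ∀ j, B (f j) z = 0 := fun j => (hsymm.eq _ _).trans (F.zf j)
  have hza : B z a = 0 := (hsymm.eq _ _).trans F.az
  let b' : V := b + ∑ j, c j • f j
  let e' : Fin (n + 1) → V := fun j => e j - c j • a
  refine ⟨b', e', ⟨⟨?_, F.hyp.ff, ?_, ?_⟩, F.aa, ?_, ?_, F.az, ?_, ?_, F.af, ?_, ?_, ?_, F.zf, ?_,
    F.dim, ?_⟩, ?_⟩
  · intro i j
    simp [e', F.hyp.ee, F.ae, F.aa, hea]
  · intro i j
    simp [e', F.hyp.ef, F.af]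
  · intro i j
    simp [e', F.hyp.fe, hfa]
  · simp [b', F.bb, F.bf, hfb, F.hyp.ff]
  · simp [b', F.ab, F.af]
  · simp [b', F.bz, hfz]
  · intro i
    simp [e', F.ae, F.aa]
  · intro i
    simp [b', e', F.be, F.hyp.fe, hfa, hba]
  · intro i
    simp [b', F.bf, F.hyp.ff]
  · intro i
    simp [e', F.ze, hza]
  · refine span_frame_eq_top_of_le F.span_eq_top fun S ha hb hz he hf => ?_
    refine ⟨ha, ?_, hz, fun i => ?_, hf⟩
    · have : b = b' - ∑ j, c j • f j := by simp [b']
      rw [this]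
      exact sub_mem hb (sum_mem fun j _ => S.smul_mem _ (hf j))
    · have : e i = e' i + c i • a := by simp [e']
      rw [this]
      exact add_mem (he i) (S.smul_mem _ ha)
  · intro r hr
    rw [F.det r hr]
    congr 1
    ext i j
    have : B (r j) a = 0 := (hsymm.eq _ _).trans (hr j)
    simp [e', this]
  · intro t
    by_cases ht : Function.Injective t
    swap
    · exact ((ω.curryLeft a).curryLeft b').map_eq_zero_of_not_injective (fun l => f (t l))
        fun h => ht fun l l' hll => h (by simp only [hll])
    obtain ⟨j, hj⟩ : ∃ j, ∀ l, t l ≠ j := by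
      by_contra h
      push Not at h
      have := Fintype.card_le_of_surjective t h
      simp at this
    choose σ hσ using fun l => Fin.exists_succAbove_eq (hj l)
    have hσi : Function.Injective σ := fun l l' h => ht (by rw [← hσ, ← hσ, h])
    have hperm := ((ω.curryLeft a).curryLeft b').map_perm (fun l => f (j.succAbove l))
      (Equiv.ofBijective σ (Finite.injective_iff_bijective.mp hσi))
    have hcomp : (fun l => f (j.succAbove l)) ∘
        (Equiv.ofBijective σ (Finite.injective_iff_bijective.mp hσi)) = fun l => f (t l) := by
      funext l
      simp [hσ]
    have hzero : ((ω.curryLeft a).curryLeft b') (fun l => f (j.succAbove l)) = 0 := by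
      have hk : ∀ k, k ≠ j → ((ω.curryLeft a).curryLeft (f k)) (fun l => f (j.succAbove l)) = 0 := by
        intro k hk
        obtain ⟨l, rfl⟩ := Fin.exists_succAbove_eq hk
        exact (ω.curryLeft a).map_eq_zero_of_eq
          (Matrix.vecCons (f (j.succAbove l)) fun l => f (j.succAbove l))
          (i := 0) (j := l.succ) (by simp) (Fin.succ_ne_zero l).symm
      have hlin : ((ω.curryLeft a).curryLeft b') (fun l => f (j.succAbove l))
          = ((ω.curryLeft a).curryLeft b) (fun l => f (j.succAbove l))
            + ∑ k, c k * ((ω.curryLeft a).curryLeft (f k)) (fun l => f (j.succAbove l)) := by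
        let G : V →ₗ[K] K :=
          { toFun := fun x => ((ω.curryLeft a).curryLeft x) (fun l => f (j.succAbove l))
            map_add' := fun x y => by rw [map_add, AlternatingMap.add_apply]
            map_smul' := fun d x => by rw [map_smul, AlternatingMap.smul_apply, RingHom.id_apply] }
        have hG : G b' = G b + ∑ k, c k * G (f k) := by
          simp only [b', map_add, map_sum, map_smul, smul_eq_mul]
        exact hG
      rw [hlin, Finset.sum_eq_single j (fun k _ h => by rw [hk k h, mul_zero])
        (fun h => absurd (Finset.mem_univ j) h)]
      have hDj : ((ω.curryLeft a).curryLeft (f j)) (fun l => f (j.succAbove l)) = D j := rfl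
      have hcj : c j = - ((ω.curryLeft a).curryLeft b) (fun l => f (j.succAbove l)) / D j := rfl
      rw [hDj, hcj, div_mul_cancel₀ _ (hD j), add_neg_cancel]
    rw [hcomp, hzero, smul_zero] at hperm
    exact hperm

end Normalization

/-- A frame exists at an isotropic vector `a` at which `ω` does not vanish. -/
theorem exists_isFrame [FiniteDimensional K V] (hK : (2 : K) ≠ 0) {B : LinearMap.BilinForm K V}
    (hsymm : B.IsSymm) (hnd : B.Nondegenerate) {n : ℕ} {ω : V [⋀^Fin (n + 1)]→ₗ[K] K}
    (hω : IsDetAtIsotropic B ω) (hdim : Module.finrank K V / 2 = n + 1) {a : V} (ha : a ≠ 0)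
    (haa : B a a = 0) {r : Fin n → V} (har : ∀ i, B a (r i) = 0)
    (hr : ω (Matrix.vecCons a r) ≠ 0) : ∃ b z e f, IsFrame B ω a b z e f := by
  obtain ⟨e, hae, hee, hdet⟩ := hω a ha haa
  have hli : LinearIndependent K (Matrix.vecCons a e) :=
    linearIndependent_vecCons_of_det_ne_zero hsymm ha har (by rwa [← hdet r har])
  have hea : ∀ i, B (e i) a = 0 := fun i => (hsymm.eq _ _).trans (hae i)
  obtain ⟨g, hg⟩ := exists_isHyperbolic hK hsymm hnd hli (by
    intro i j
    refine Fin.cases ?_ (fun i => ?_) i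
    · exact map_vecCons_eq_zero haa hae j
    · exact map_vecCons_eq_zero (hea i) (hee i) j)
  obtain ⟨z, hze, hzf, htop, hd⟩ := hg.exists_complement hsymm hnd (by simpa using hdim)
  have hge : ∀ i, B (g 0) (e i) = 0 := fun i => by
    simpa [(Fin.succ_ne_zero i).symm] using hg.fe 0 i.succ
  refine ⟨g 0, z, e, fun i => g i.succ, ⟨hee, fun i j => hg.ff _ _, fun i j => ?_, fun i j => ?_⟩,
    haa, hg.ff 0 0, ?_, ?_, ?_, hae, fun i => ?_, hge, fun i => hg.ff _ _, fun i => ?_,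
    fun i => hzf _, ?_, ?_, hdet⟩
  · simpa using hg.ef i.succ j.succ
  · simpa using hg.fe i.succ j.succ
  · simpa using hg.ef 0 0
  · exact (hsymm.eq _ _).trans (hze 0)
  · exact (hsymm.eq _ _).trans (hzf 0)
  · simpa [(Fin.succ_ne_zero i).symm] using hg.ef 0 i.succ
  · simpa using hze i.succ
  · rw [eq_top_iff, ← htop]
    refine sup_le (Submodule.span_le.mpr ?_)
      (le_sup_of_le_left (le_sup_of_le_left le_sup_right))
    rintro _ ⟨i | i, rfl⟩
    · refine Fin.cases ?_ (fun i => ?_) i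
      · exact Submodule.mem_sup_right (Submodule.mem_span_singleton_self _)
      · exact Submodule.mem_sup_left (Submodule.mem_sup_left (Submodule.mem_sup_left
          (left_mem_hypSpan _ _ i)))
    · refine Fin.cases ?_ (fun i => ?_) i
      · exact Submodule.mem_sup_left (Submodule.mem_sup_right
          (Submodule.mem_span_singleton_self _))
      · exact Submodule.mem_sup_left (Submodule.mem_sup_left (Submodule.mem_sup_left
          (right_mem_hypSpan e (fun i => g i.succ) i)))
  · simpa using hd

/-! ### The case where `ω` vanishes at all isotropic vectors -/

theorem exists_isotropic_of_wittIndex [FiniteDimensional K V] {B : LinearMap.BilinForm K V}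
    {p : ℕ} (hp : wittIndex B = p) :
    ∃ e : Fin p → V, LinearIndependent K e ∧ ∀ i j, B (e i) (e j) = 0 := by
  subst hp
  have hmem : wittIndex B ∈ {d : ℕ | ∃ L : Submodule K V, IsIsotropicSubspace B L ∧
      Module.finrank K L = d} := by
    refine Nat.sSup_mem ⟨0, ⊥, ?_, finrank_bot K V⟩ ⟨Module.finrank K V, ?_⟩
    · rintro x hx y -
      rw [(Submodule.mem_bot K).mp hx, map_zero, LinearMap.zero_apply]
    · rintro _ ⟨L, -, rfl⟩
      exact Submodule.finrank_le L
  obtain ⟨L, hL, hd⟩ := hmem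
  let bs := Module.finBasisOfFinrankEq K L hd
  exact ⟨fun i => bs i, bs.linearIndependent.map' L.subtype (Submodule.ker_subtype L),
    fun i j => hL _ (bs i).2 _ (bs j).2⟩

/-- A form vanishing at all isotropic vectors is zero. -/
theorem eq_zero_of_forall_isotropic [FiniteDimensional K V] (hK : (2 : K) ≠ 0)
    {B : LinearMap.BilinForm K V} (hsymm : B.IsSymm) (hnd : B.Nondegenerate) {m : ℕ}
    (hdim : Module.finrank K V / 2 = m + 4) (hwitt : wittIndex B = m + 4)
    {ω : V [⋀^Fin (m + 4)]→ₗ[K] K}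
    (h : ∀ v : V, v ≠ 0 → B v v = 0 → ∀ r : Fin (m + 3) → V, (∀ i, B v (r i) = 0) →
      ω (Matrix.vecCons v r) = 0) : ω = 0 := by
  obtain ⟨e, he, hee⟩ := exists_isotropic_of_wittIndex hwitt
  obtain ⟨f, hef⟩ := exists_isHyperbolic hK hsymm hnd he hee
  obtain ⟨z, hze, hzf, htop, -⟩ := hef.exists_complement hsymm hnd (by simpa using hdim)
  have hv0 : ∀ v : V, (∃ i, B v (e i) ≠ 0) → v ≠ 0 := by
    rintro v ⟨i, hi⟩ rfl
    simp at hi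
  have h1 : VanishesOn ω (hypSpan K e f) := by
    refine VanishesAtIsotropic.vanishesOn (c := True) hK hef ?_ (by simp) (by simp)
      (by simp only [Fintype.card_fin]; omega) (Or.inl trivial) (Or.inl trivial)
    intro s _ i₀ hvv hve hperp _
    rw [map_eq_zero_iff_vecCons ω s i₀]
    exact h _ (hv0 _ hve) hvv _ fun l => hperp _ (Fin.succAbove_ne i₀ l)
  have h2 : VanishesOn (ω.curryLeft z) (hypSpan K e f) := by
    refine VanishesAtIsotropic.vanishesOn (c := True) hK hef ?_ (by simp) (by simp)
      (by simp only [Fintype.card_fin]; omega) (Or.inl trivial) (Or.inl trivial)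
    intro s hs i₀ hvv hve hperp _
    have hvz : B (s i₀) z = 0 :=
      (hsymm.eq _ _).trans (hypSpan_induction (B z) hze hzf (hs i₀))
    refine (map_eq_zero_iff_vecCons ω (Matrix.vecCons z s) i₀.succ).mpr ?_
    exact h _ (hv0 _ hve) hvv _ fun l =>
      map_vecCons_eq_zero_of_ne hvz hperp _ (Fin.succAbove_ne _ l)
  have h3 := h1.sup_span_singleton h2
  rw [htop] at h3
  ext t
  exact h3 t fun _ => Submodule.mem_top

end IsoGrass

/-! ### Conclusion -/

theorem mainTheorem1 {K V : Type*} [Field K] [AddCommGroup V] [Module K V]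
    [FiniteDimensional K V] (hK : ringChar K ≠ 2)
    (B : LinearMap.BilinForm K V) (hsymm : B.IsSymm) (hnd : B.Nondegenerate)
    (p : ℕ) (hp : p = Module.finrank K V / 2) (hwitt : IsoGrass.wittIndex B = p)
    (hdim : 8 < Module.finrank K V)
    (ω : ⋀[K]^p V)
    (hω : ∀ v : V, v ≠ 0 → B v v = 0 →
      IsoGrass.Phi B v p ω ∈ IsoGrass.isoGrassmannCone (IsoGrass.redForm B hsymm v) (p - 1)) :
    ω ∈ IsoGrass.isoGrassmannCone B p := by
  have hK2 : (2 : K) ≠ 0 := Ring.two_ne_zero hK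
  obtain ⟨m, rfl⟩ : ∃ m, p = m + 4 := ⟨p - 4, by omega⟩
  have hdet : IsoGrass.IsDetAtIsotropic B (IsoGrass.toForm B (m + 4) ω) :=
    fun v hv hvv => IsoGrass.exists_det_of_Phi_mem hsymm (hω v hv hvv)
  by_cases hex : ∀ v : V, v ≠ 0 → B v v = 0 → ∀ r : Fin (m + 3) → V, (∀ i, B v (r i) = 0) →
      IsoGrass.toForm B (m + 4) ω (Matrix.vecCons v r) = 0
  · have h0 := IsoGrass.eq_zero_of_forall_isotropic hK2 hsymm hnd hp.symm hwitt hex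
    -- The degree is positive, so the zero tuple has wedge product zero.
    refine ⟨0, by simp, IsoGrass.toForm_injective hnd _ ?_⟩
    rw [h0, (exteriorPower.ιMulti K (m + 4)).map_zero]
    ext r
    simp [IsoGrass.toForm_apply]
  · push Not at hex
    obtain ⟨a, ha, haa, r, har, hr⟩ := hex
    obtain ⟨b, z, e, f, F⟩ :=
      IsoGrass.exists_isFrame hK2 hsymm hnd hdet hp.symm ha haa har hr
    -- The order matters: the second normalization leaves `z` and `f` alone and so preserves `hz`,
    -- whereas the first one changes `b`.
    obtain ⟨b, z, F, hz⟩ := F.exists_normalized_right hK2 hsymm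
    obtain ⟨b, e, F, hab⟩ := F.exists_normalized_left hsymm
    refine ⟨Matrix.vecCons b e, fun i j => ?_, ?_⟩
    · refine Fin.cases ?_ (fun i => ?_) i
      · exact IsoGrass.map_vecCons_eq_zero F.bb F.be j
      · exact IsoGrass.map_vecCons_eq_zero ((hsymm.eq _ _).trans (F.be i)) (F.hyp.ee i) j
    · exact IsoGrass.toForm_injective hnd _
        (F.eq_toForm hK2 hsymm hnd hdet hdim hab hz).symm
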